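/- Let $d\in\{1,2\}$, $q\in\mathbb N$, $\Omega_0=\{1,\dots,q\}$ and $\Omega=\Omega_0^{\mathbb Z^d}$ with the product topology and its Borel $\sigma$-algebra. For $\eta\in\Omega$ let $\eta^{x,i}$ be $\eta$ with the value at $x$ replaced by $i$, let $[\eta_\Lambda]=\{\omega:\omega_\Lambda=\eta_\Lambda\}$, and for $f:\Omega\to\mathbb R$ let $\delta_y f=\sup\{|f(\eta)-f(\xi)|:\eta_z=\xi_z\ \forall z\ne y\}$. Translation invariance is not assumed anywhere. *Rates.* Let $c_x(\eta,i)$, for $x\in\mathbb Z^d$, $\eta\in\Omega$, $i\in\Omega_0$, satisfy - (R1) $\sup_x\sum_i\|c_x(\cdot,i)\|_\infty<\infty$; - (R2) $\eta\mapsto c_x(\eta,i)$ is continuous for all $x,i$; - (R3) $\inf_{x,\eta,i}c_x(\eta,i)>0$; - (R4) $\sum_{y\in\mathbb Z^d}|y|\,\sup_{x}\sum_{i}\delta_{x+y}c^{\ne}_{x,i}<\infty$, where $c^{\ne}_{x,i}(\eta)=c_x(\eta,i)$ if $i\ne\eta_x$ and $0$ if $i=\eta_x$. Let $\mathscr L f(\eta)=\sum_x\sum_i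 c_x(\eta,i)\,[f(\eta^{x,i})-f(\eta)]$ for $f\in D(\Omega)=\{f\in C(\Omega):\sum_x\delta_x f<\infty\}$, and let $(P_t)_{t\ge0}$ be the Markov semigroup on $C(\Omega)$ generated by $\mathscr L$, i.e. the strongly continuous, positive, unit-preserving semigroup whose generator is the closure of $(\mathscr L,D(\Omega))$. For a probability measure $\nu$ on $\Omega$, $\nu P_t$ is the probability measure with $\int f\,d(\nu P_t)=\int P_tf\,d\nu$ for all $f\in C(\Omega)$. *Specification.* Let $\gamma=(\gamma_\Lambda)$, indexed by the finite sets $\Lambda\subset\mathbb Z^d$, be a specification, i.e. a family of probability kernels $\gamma_\Lambda(\cdot\,|\,\eta_{\Lambda^c})$ on $\Omega$, depending measurably on $\eta_{\Lambda^c}$, that are proper ($\gamma_\Lambda(A\cap B|\eta)=\mathbf 1_B(\eta)\gamma_\Lambda(A|\eta)$ for $A$ measurable and $B$ depending only on the coordinates in $\Lambda^c$) and consistent ($\gamma_\Lambda\gamma_\Delta=\gamma_\Lambda$ for $\Delta\subset\Lambda$). Assume - (S1) quasilocality: for every finite $\Lambda$, $\ \sup_{\eta,\xi}|\gamma_\Lambda(\eta_\Lambda|\eta_{\Delta\setminus\Lambda}\xi_{\Delta^c})-\gamma_\Lambda(\eta_\Lambda|\eta_{\Lambda^c})|\to0$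 as $\Delta\uparrow\mathbb Z^d$; - (S2) non-nullness: $\inf_\eta\gamma_{\{0\}}(\eta_0|\eta_{0^c})>0$; - (S3) $\sum_{y\in\mathbb Z^d}|y|\,\sup_x\delta_{x+y}\gamma_x<\infty$, where $\gamma_x$ denotes the function $\eta\mapsto\gamma_{\{x\}}(\eta_x|\eta_{x^c})$. *Reversible Gibbs measure.* Suppose there is a probability measure $\mu$ on $\Omega$ that is a Gibbs measure for $\gamma$ ($\mu\gamma_\Lambda=\mu$ for all finite $\Lambda$) and is reversible for $(P_t)$, i.e. $\int f\,P_tg\,d\mu=\int g\,P_tf\,d\mu$ for all $f,g\in C(\Omega)$ and $t\ge0$. Then the measure-valued dynamics $(t,\nu)\mapsto\nu P_t$ has no non-trivial time-periodic orbits: there is no probability measure $\nu$ on $\Omega$ such that $(\nu P_t)_{t\ge0}$ is non-constant and such that, for some $T>0$, $\nu P_t=\nu P_{t+T}$ for all $t\ge0$. -/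

import Mathlib

open MeasureTheory ProbabilityTheory Filter Topology
open scoped NNReal ENNReal

namespace IPS

/-- Configurations `ℤ^d → {1,…,q}`, with the product topology and product sigma-algebra
(`Fin q` is discrete). -/
abbrev Config (d q : ℕ) : Type := (Fin d → ℤ) → Fin q

variable {d q : ℕ}

/-- The oscillation `δ_y f` of `f` at the site `y`: the supremum of `|f η - f ξ|` over all pairs of
configurations that agree off `y`, as an extended nonnegative number. -/
noncomputable def osc (y : Fin d → ℤ) (f : Config d q → ℝ) : ℝ≥0∞ :=
  ⨆ (η : Config d q) (ξ : Config d q) (_ : ∀ z, z ≠ y → η z = ξ z), ENNReal.ofReal |f η - f ξ|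

/-! ### Specifications and Gibbs measures -/

/-- The cylinder set `[η_Λ]`. -/
def cyl (Λ : Finset (Fin d → ℤ)) (η : Config d q) : Set (Config d q) :=
  {ω | ∀ z ∈ Λ, ω z = η z}

/-- A specification: proper, consistent probability kernels `γ_Λ` from `Ω_{Λᶜ}` to `Ω`, indexed by
the finite sets `Λ ⊂ ℤ^d`. A kernel from `Ω_{Λᶜ}` is a kernel on `Ω` that is measurable with respect
to the sigma-algebra generated by the coordinates outside `Λ`. -/
structure Specification (d q : ℕ) where
  ker : (Λ : Finset (Fin d → ℤ)) →
    Kernel[cylinderEvents ((Λ : Set (Fin d → ℤ))ᶜ), MeasurableSpace.pi] (Config d q) (Config d q)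
  isProb : ∀ Λ η, IsProbabilityMeasure (ker Λ η)
  isProper : ∀ Λ, (ker Λ).IsProper
  consistent : ∀ Δ Λ : Finset (Fin d → ℤ), Δ ⊆ Λ → ∀ (η : Config d q) (A : Set (Config d q)),
    MeasurableSet A → ∫⁻ ω, ker Δ ω A ∂(ker Λ η) = ker Λ η A

/-- `γ.prob Λ η ζ` is `γ_Λ(η_Λ | ζ_{Λᶜ})`. -/
noncomputable def Specification.prob (γ : Specification d q) (Λ : Finset (Fin d → ℤ))
    (η ζ : Config d q) : ℝ :=
  (γ.ker Λ ζ).real (cyl Λ η)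

/-- The DLR equations `μ γ_Λ = μ` for all finite `Λ`. -/
def IsGibbs (γ : Specification d q) (μ : ProbabilityMeasure (Config d q)) : Prop :=
  ∀ (Λ : Finset (Fin d → ℤ)) (A : Set (Config d q)), MeasurableSet A →
    ∫⁻ ω, γ.ker Λ ω A ∂(μ : Measure (Config d q)) = (μ : Measure (Config d q)) A

/-- Quasilocality: for every finite `Λ`, the quantity
`sup_{η,ξ} |γ_Λ(η_Λ | η_{Δ∖Λ} ξ_{Δᶜ}) - γ_Λ(η_Λ | η_{Λᶜ})|` tends to `0` as `Δ ↑ ℤ^d`. -/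
def Quasilocal (γ : Specification d q) : Prop :=
  ∀ Λ : Finset (Fin d → ℤ), ∀ ε > 0, ∃ Δ₀ : Finset (Fin d → ℤ), ∀ Δ, Δ₀ ⊆ Δ →
    ∀ η ξ : Config d q, |γ.prob Λ η (Δ.piecewise η ξ) - γ.prob Λ η η| ≤ ε

/-- Non-nullness: `inf_η γ_0(η_0 | η_{0ᶜ}) ≥ δ` for some `δ > 0`. -/
def NonNull (γ : Specification d q) : Prop :=
  ∃ δ > 0, ∀ η : Config d q, δ ≤ γ.prob {0} η η

/-- Conditions (S1)-(S3) on a specification. In the sum, the term `y = 0` has weight `0`. -/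
structure SpecAssumptions (γ : Specification d q) : Prop where
  quasilocal : Quasilocal γ
  nonNull : NonNull γ
  decay : ∑' y : Fin d → ℤ, ‖y‖ₑ * ⨆ x : Fin d → ℤ, osc (x + y) (fun η => γ.prob {x} η η) < ⊤

/-! ### Rates, Markov semigroups and their generators -/

/-- Conditions (R1)-(R4) on the rates; `c x η i` is the rate at which the spin at `x` jumps to the
value `i` when the configuration is `η`. In (R4) only the rates of actual changes of the spin
(`i ≠ η x`) enter, and the term `y = 0` has weight `0`. -/
structure RateAssumptions (c : (Fin d → ℤ) → Config d q → Fin q → ℝ) : Prop where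
  bounded : ⨆ x, ∑ i, ⨆ η, ENNReal.ofReal |c x η i| < ⊤
  continuous : ∀ x i, Continuous fun η => c x η i
  positive : ∃ δ > 0, ∀ x η i, δ ≤ c x η i
  decay : ∑' y : Fin d → ℤ,
    ‖y‖ₑ * ⨆ x : Fin d → ℤ, ∑ i,
      osc (x + y) (fun η => if η x = i then 0 else c x η i) < ⊤

/-- A Markov semigroup on `C(Ω)`. -/
structure MarkovSemigroup (d q : ℕ) where
  P : ℝ≥0 → C(Config d q, ℝ) →L[ℝ] C(Config d q, ℝ)
  zero : ∀ f, P 0 f = f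
  add : ∀ s t f, P (s + t) f = P s (P t f)
  one : ∀ t, P t 1 = 1
  nonneg : ∀ t f, 0 ≤ f → 0 ≤ P t f
  continuous : ∀ f, Continuous fun t => P t f

/-- The graph of the (strong) infinitesimal generator of a Markov semigroup. -/
def MarkovSemigroup.generatorGraph (S : MarkovSemigroup d q) :
    Set (C(Config d q, ℝ) × C(Config d q, ℝ)) :=
  {p | Tendsto (fun t : ℝ≥0 => (t : ℝ)⁻¹ • (S.P t p.1 - p.1)) (𝓝[>] 0) (𝓝 p.2)}

/-- The graph of `ℒ f(η) = ∑_x ∑_i c_x(η,i) [f(η^{x,i}) - f(η)]` on the space `D(Ω)` of continuous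
functions with finite total oscillation. -/
def preGeneratorGraph (c : (Fin d → ℤ) → Config d q → Fin q → ℝ) :
    Set (C(Config d q, ℝ) × C(Config d q, ℝ)) :=
  {p | ∑' x : Fin d → ℤ, osc x p.1 < ⊤ ∧
    ∀ η, HasSum (fun x => ∑ i, c x η i * (p.1 (Function.update η x i) - p.1 η)) (p.2 η)}

/-- `S` is the Markov semigroup generated by `ℒ`: its generator is the closure of `ℒ` on its core
`D(Ω)`. -/
def MarkovSemigroup.IsGeneratedBy (S : MarkovSemigroup d q)
    (c : (Fin d → ℤ) → Config d q → Fin q → ℝ) : Prop :=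
  S.generatorGraph = closure (preGeneratorGraph c)

/-- `μ` is reversible for the semigroup: `∫ f P_t g dμ = ∫ g P_t f dμ` for all `f, g ∈ C(Ω)`. -/
def MarkovSemigroup.IsReversible (S : MarkovSemigroup d q)
    (μ : ProbabilityMeasure (Config d q)) : Prop :=
  ∀ (t : ℝ≥0) (f g : C(Config d q, ℝ)),
    ∫ ω, f ω * S.P t g ω ∂(μ : Measure (Config d q)) =
      ∫ ω, g ω * S.P t f ω ∂(μ : Measure (Config d q))

/-- Existence of `ν P_t`, by the Riesz-Markov-Kakutani theorem. -/
theorem MarkovSemigroup.exists_evolve (S : MarkovSemigroup d q)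
    (ν : ProbabilityMeasure (Config d q)) (t : ℝ≥0) :
    ∃ ν' : ProbabilityMeasure (Config d q), ∀ f : C(Config d q, ℝ),
      ∫ ω, f ω ∂(ν' : Measure (Config d q)) = ∫ ω, S.P t f ω ∂(ν : Measure (Config d q)) := by
  have hint : ∀ f : C(Config d q, ℝ), Integrable (fun ω => f ω) (ν : Measure (Config d q)) :=
    fun f => (BoundedContinuousFunction.mkOfCompact f).integrable _
  let Φ : CompactlySupportedContinuousMap (Config d q) ℝ →ₚ[ℝ] ℝ :=
    { toFun := fun g => ∫ ω, S.P t g.toContinuousMap ω ∂(ν : Measure (Config d q))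
      map_add' := fun g g' => by
        have h : (g + g').toContinuousMap = g.toContinuousMap + g'.toContinuousMap := rfl
        rw [h, map_add]
        exact integral_add (hint _) (hint _)
      map_smul' := fun a g => by
        have h : (a • g).toContinuousMap = a • g.toContinuousMap := rfl
        rw [h, map_smul]
        exact integral_smul a _
      monotone' := fun g g' hgg' => by
        refine integral_mono (hint _) (hint _) fun ω => ?_
        have h0 : (0 : C(Config d q, ℝ)) ≤ g'.toContinuousMap - g.toContinuousMap :=
          sub_nonneg.2 fun ω => hgg' ω
        have h1 := S.nonneg t _ h0
        rw [map_sub] at h1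
        exact (sub_nonneg.1 h1) ω }
  have key : ∀ f : C(Config d q, ℝ),
      ∫ ω, f ω ∂(RealRMK.rieszMeasure Φ) = ∫ ω, S.P t f ω ∂(ν : Measure (Config d q)) :=
    fun f => RealRMK.integral_rieszMeasure Φ
      { toContinuousMap := f, hasCompactSupport' := HasCompactSupport.of_compactSpace _ }
  have h1 := key 1
  rw [S.one] at h1
  have hprob : IsProbabilityMeasure (RealRMK.rieszMeasure Φ) := by
    simp only [ContinuousMap.one_apply, integral_const, smul_eq_mul, mul_one,
      probReal_univ] at h1
    exact ⟨by rwa [measureReal_def, ENNReal.toReal_eq_one_iff] at h1⟩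
  exact ⟨⟨RealRMK.rieszMeasure Φ, hprob⟩, key⟩

/-- The time-evolved measure `ν P_t`: the probability measure with `∫ f d(ν P_t) = ∫ P_t f dν` for
all `f ∈ C(Ω)`. -/
noncomputable def MarkovSemigroup.evolve (S : MarkovSemigroup d q)
    (ν : ProbabilityMeasure (Config d q)) (t : ℝ≥0) : ProbabilityMeasure (Config d q) :=
  (S.exists_evolve ν t).choose

theorem MarkovSemigroup.integral_evolve (S : MarkovSemigroup d q)
    (ν : ProbabilityMeasure (Config d q)) (t : ℝ≥0) (f : C(Config d q, ℝ)) :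
    ∫ ω, f ω ∂(S.evolve ν t : Measure (Config d q)) =
      ∫ ω, S.P t f ω ∂(ν : Measure (Config d q)) :=
  (S.exists_evolve ν t).choose_spec f

/-- The defining property determines `ν P_t`. -/
theorem MarkovSemigroup.evolve_unique (S : MarkovSemigroup d q)
    (ν ν' : ProbabilityMeasure (Config d q)) (t : ℝ≥0)
    (h : ∀ f : C(Config d q, ℝ), ∫ ω, f ω ∂(ν' : Measure (Config d q)) =
      ∫ ω, S.P t f ω ∂(ν : Measure (Config d q))) : ν' = S.evolve ν t := by
  apply Subtype.ext
  have i1 : IsProbabilityMeasure ν'.1 := ν'.2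
  have i2 : IsProbabilityMeasure (S.evolve ν t).1 := (S.evolve ν t).2
  refine ext_of_forall_integral_eq_of_IsFiniteMeasure fun f => ?_
  have h1 := (h f.toContinuousMap).trans (S.integral_evolve ν t f.toContinuousMap).symm
  exact h1

end IPS

namespace IPS

/-! ### Elementary inequalities -/

/-! The entropy argument is run over one period. Let H_n be the entropy of ν P_t relative to μ on
the box of radius n, and let D_x^n be the dissipation at x in that box: the sum over jumps at x of
(F - F')² / (F + F'), where F and F' are the flows of a jump and of its reversal. If the rates
inside the box depended only on the box, detailed balance for μ would give H_n' ≤ -(1/2) Σ_x D_x^n.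
The true rates deviate from this by at most e(n - |x|), where e is summable by (R4), and this adds
errors bounded by a constant times e(n - |x|) √(D_x^n) (`entropy_production_le`).

Over a period H_n does not change, so the dissipation is controlled by the errors. Since D_x^n
increases with n (`dissipation_mono`), the quantity W_n = Σ_x (Σ_{j ≤ n-|x|} e j) D_x^n has an
increment W_{n+1} - W_n that dominates Σ_x e(n+1-|x|) D_x^{n+1} (`sum_mul_dissipation_le_sub`). By
Cauchy-Schwarz the squared error is at most a constant times Σ_x e(n+1-|x|) times this increment,
and the sum is O(n) because spheres in dimension at most 2 have O(n) sites (`sum_box_le`,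
`sum_sqrt_le`).

For the integral w_n of W_n over a period this yields w_{n+1}² ≤ K (n+2) (w_{n+1} - w_n), and the
divergence of the harmonic series forces w_n = 0 (`eq_zero_of_sq_le_mul_sub`). Hence all dissipation
vanishes along the orbit, flows cancel in pairs, and every cylinder mass is constant in time
(`IsGeneratedBy.evolve_eq_of_periodic`). -/

theorem abs_log_sub_log_le {δ a b : ℝ} (hδ : 0 < δ) (ha : δ ≤ a) (hb : δ ≤ b) :
    |Real.log a - Real.log b| ≤ |a - b| / δ := by
  have key : ∀ a b : ℝ, δ ≤ a → δ ≤ b → Real.log a - Real.log b ≤ |a - b| / δ := by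
    intro a b ha hb
    have ha0 := hδ.trans_le ha
    have hb0 := hδ.trans_le hb
    rw [← Real.log_div ha0.ne' hb0.ne']
    calc Real.log (a / b) ≤ a / b - 1 := Real.log_le_sub_one_of_pos (div_pos ha0 hb0)
      _ = (a - b) / b := by field_simp
      _ ≤ |a - b| / b := by gcongr; exact le_abs_self _
      _ ≤ |a - b| / δ := by gcongr
  rw [abs_le]
  refine ⟨?_, key a b ha hb⟩
  have := key b a hb ha
  rw [abs_sub_comm b a] at this
  linarith

/-- Replaces an entropy production term by a quotient suited to Cauchy-Schwarz and to coarse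
graining. For b ≤ a it follows from log (b / a) ≤ b / a - 1 and a ≤ a + b. -/
theorem sq_div_add_le_mul_log {a b : ℝ} (ha : 0 < a) (hb : 0 < b) :
    (a - b) ^ 2 / (a + b) ≤ (a - b) * (Real.log a - Real.log b) := by
  have key : ∀ a b : ℝ, 0 < a → 0 < b → b ≤ a →
      (a - b) ^ 2 / (a + b) ≤ (a - b) * (Real.log a - Real.log b) := by
    intro a b ha hb hab
    have h1 : Real.log (b / a) ≤ b / a - 1 := Real.log_le_sub_one_of_pos (div_pos hb ha)
    rw [Real.log_div hb.ne' ha.ne'] at h1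
    have h2 : (a - b) / (a + b) ≤ (a - b) / a := by
      apply div_le_div_of_nonneg_left _ ha <;> linarith
    have h3 : (a - b) / a = 1 - b / a := by field_simp
    rw [sq, mul_div_assoc]
    apply mul_le_mul_of_nonneg_left _ (by linarith)
    linarith
  rcases le_total b a with h | h
  · exact key a b ha hb h
  · have := key b a hb ha h
    have e1 : (a - b) ^ 2 / (a + b) = (b - a) ^ 2 / (b + a) := by rw [add_comm b a]; ring
    rw [e1]; linarith

/-- The entropy production estimate for an involution `ι` along which the flow `F` is balanced up
to `κ` by the potential `g`. -/
theorem sum_mul_le_of_involutive {J : Type*} [Fintype J] {ι : J → J} (hι : Function.Involutive ι)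
    {F g : J → ℝ} (hF : ∀ j, 0 < F j) {κ B : ℝ} (hκ : 0 ≤ κ)
    (h : ∀ j, |(g (ι j) - g j) - (Real.log (F (ι j)) - Real.log (F j))| ≤ κ)
    (hB : ∑ j, F j ≤ B) :
    ∑ j, (F (ι j) - F j) * g j ≤
      (-∑ j, (F j - F (ι j)) ^ 2 / (F j + F (ι j)) +
        κ * √(2 * B * ∑ j, (F j - F (ι j)) ^ 2 / (F j + F (ι j)))) / 2 := by
  have hsum : ∀ f : J → ℝ, ∑ j, f (ι j) = ∑ j, f j := fun f => Equiv.sum_comp hι.toPerm f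
  set D := ∑ j, (F j - F (ι j)) ^ 2 / (F j + F (ι j)) with hD
  -- The net flow is antisymmetric under `ι`, so only differences of `g` along a jump matter.
  have hsymm : ∑ j, (F (ι j) - F j) * g j = (∑ j, (F (ι j) - F j) * (g j - g (ι j))) / 2 := by
    have h1 := hsum fun j => (F (ι j) - F j) * g j
    simp only [hι _] at h1
    have h2 : ∑ j, (F (ι j) - F j) * (g j - g (ι j)) =
        ∑ j, (F (ι j) - F j) * g j + ∑ j, (F j - F (ι j)) * g (ι j) := by
      rw [← Finset.sum_add_distrib]
      exact Finset.sum_congr rfl fun j _ => by ring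
    rw [h2, h1]; ring
  have hterm : ∀ j, (F (ι j) - F j) * (g j - g (ι j)) ≤
      -((F j - F (ι j)) ^ 2 / (F j + F (ι j))) + κ * |F j - F (ι j)| := by
    intro j
    have h1 := sq_div_add_le_mul_log (hF j) (hF (ι j))
    set err := (g (ι j) - g j) - (Real.log (F (ι j)) - Real.log (F j)) with herr
    have h2 : (F (ι j) - F j) * (g j - g (ι j)) =
        -((F j - F (ι j)) * (Real.log (F j) - Real.log (F (ι j)))) + (F j - F (ι j)) * err := by
      rw [herr]; ring
    have h3 : (F j - F (ι j)) * err ≤ κ * |F j - F (ι j)| := by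
      calc (F j - F (ι j)) * err ≤ |(F j - F (ι j)) * err| := le_abs_self _
        _ = |F j - F (ι j)| * |err| := abs_mul _ _
        _ ≤ |F j - F (ι j)| * κ := by gcongr; exact h j
        _ = _ := mul_comm _ _
    linarith
  -- Cauchy-Schwarz after writing |a - b| as √(a + b) times |a - b| / √(a + b).
  have hCS : ∑ j, |F j - F (ι j)| ≤ √(2 * B * D) := by
    apply Real.le_sqrt_of_sq_le
    have h1 : (∑ j, |F j - F (ι j)|) ^ 2 ≤
        (∑ j, (F j + F (ι j))) * ∑ j, (F j - F (ι j)) ^ 2 / (F j + F (ι j)) := by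
      apply Finset.sum_sq_le_sum_mul_sum_of_sq_le_mul
      · intro j _; exact (add_pos (hF _) (hF _)).le
      · intro j _; exact div_nonneg (sq_nonneg _) (add_pos (hF _) (hF _)).le
      · intro j _
        have := (add_pos (hF j) (hF (ι j))).ne'
        rw [sq_abs]; apply le_of_eq; field_simp
    have h2 : ∑ j, (F j + F (ι j)) ≤ 2 * B := by
      rw [Finset.sum_add_distrib, hsum F]; linarith
    refine h1.trans (mul_le_mul_of_nonneg_right h2 ?_)
    exact Finset.sum_nonneg fun j _ => div_nonneg (sq_nonneg _) (add_pos (hF _) (hF _)).le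
  rw [hsymm]
  apply div_le_div_of_nonneg_right _ zero_le_two
  calc ∑ j, (F (ι j) - F j) * (g j - g (ι j))
      ≤ ∑ j, (-((F j - F (ι j)) ^ 2 / (F j + F (ι j))) + κ * |F j - F (ι j)|) :=
        Finset.sum_le_sum fun j _ => hterm j
    _ = -D + κ * ∑ j, |F j - F (ι j)| := by
        rw [Finset.sum_add_distrib, Finset.sum_neg_distrib, Finset.mul_sum]
    _ ≤ _ := by gcongr

/-- A nonnegative sequence whose increments dominate `W ^ 2 / (K n)` vanishes, because the harmonic
series diverges. -/
theorem eq_zero_of_sq_le_mul_sub {W : ℕ → ℝ} {K : ℝ} (hK : 0 < K) (h0 : ∀ n, 0 ≤ W n)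
    (h : ∀ n, W (n + 1) ^ 2 ≤ K * (n + 2) * (W (n + 1) - W n)) (n : ℕ) : W n = 0 := by
  have hmono : Monotone W := by
    apply monotone_nat_of_le_succ
    intro n
    have h1 : 0 ≤ K * (n + 2) * (W (n + 1) - W n) := (sq_nonneg _).trans (h n)
    have h2 : 0 < K * ((n : ℝ) + 2) := by positivity
    have := nonneg_of_mul_nonneg_right h1 h2
    linarith
  by_contra hn
  have hpos : 0 < W n := lt_of_le_of_ne (h0 n) (Ne.symm hn)
  have hp : ∀ k, 0 < W (n + k) := fun k => hpos.trans_le (hmono (Nat.le_add_right _ _))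
  -- By monotonicity W_k W_{k+1} ≤ W_{k+1}², so the hypothesis gives 1 / (k + 2) ≤ K (1 / W_k - 1 /
  -- W_{k+1}), which telescopes. The right side stays bounded, unlike the harmonic sums.
  have key : ∀ k, ∑ j ∈ Finset.range k, 1 / (((j + (n + 2) : ℕ) : ℝ)) ≤ K * (1 / W n - 1 / W (n + k)) := by
    intro k
    induction k with
    | zero => simp
    | succ k ih =>
      rw [Finset.sum_range_succ]
      have h1 := h (n + k)
      have ha := hp k
      have hb := hp (k + 1)
      rw [show n + (k + 1) = n + k + 1 from rfl] at hb ⊢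
      have hab : W (n + k) ≤ W (n + k + 1) := hmono (Nat.le_succ _)
      have h2 : 1 / (((k + (n + 2) : ℕ) : ℝ)) ≤ K * (1 / W (n + k) - 1 / W (n + k + 1)) := by
        have hc : (0 : ℝ) < ((k + (n + 2) : ℕ) : ℝ) := by positivity
        push_cast at h1 hc ⊢
        rw [div_sub_div _ _ ha.ne' hb.ne', mul_div_assoc', div_le_div_iff₀ hc (by positivity)]
        have : W (n + k) * W (n + k + 1) ≤ W (n + k + 1) ^ 2 := by nlinarith
        linarith
      linarith
  have hdiv : Tendsto (fun k => ∑ j ∈ Finset.range k, 1 / (((j + (n + 2) : ℕ) : ℝ))) atTop atTop := by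
    rw [← not_summable_iff_tendsto_nat_atTop_of_nonneg (fun _ => by positivity)]
    rw [summable_nat_add_iff (f := fun j : ℕ => 1 / (j : ℝ))]
    exact Real.not_summable_one_div_natCast
  obtain ⟨k, hk⟩ := (hdiv.eventually_gt_atTop (K * (1 / W n))).exists
  have := key k
  have h3 : 0 < K * (1 / W (n + k)) := by have := hp k; positivity
  linarith [mul_sub K (1 / W n) (1 / W (n + k))]

/-- Recovers a geometric mean bound from its Young form. The choice l = E T / w turns the second
summand into w / 2, which is absorbed on the left; it also works when A X = 0. -/
theorem le_mul_of_forall_le {w E A X T : ℝ} (hw : 0 ≤ w) (hE : 0 < E) (hT : 0 < T)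
    (hAX : 0 ≤ A * X)
    (h : ∀ l : ℝ, 0 < l → w ≤ E * ((l * (A * X) + T * l⁻¹) / 2)) : w ^ 2 ≤ E ^ 2 * T * A * X := by
  rcases hw.eq_or_lt with rfl | hw
  · have : 0 ≤ E ^ 2 * T * (A * X) := by positivity
    linarith
  · have h1 := h (E * T / w) (by positivity)
    have h2 : E * ((E * T / w * (A * X) + T * (E * T / w)⁻¹) / 2) =
        E ^ 2 * T * A * X / w / 2 + w / 2 := by
      field_simp
    rw [h2] at h1
    have h3 : w ≤ E ^ 2 * T * A * X / w := by linarith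
    rwa [le_div_iff₀ hw, ← sq] at h3

/-- The quantity `∑ (a - b) ^ 2 / (a + b)` decreases under coarse graining. -/
theorem sum_sq_div_le_of_fiber_sum {J J' : Type*} [Fintype J] [Fintype J'] [DecidableEq J]
    {ι : J → J} {ι' : J' → J'} (hι : Function.Involutive ι) (hι' : Function.Involutive ι')
    {ρ : J' → J} (hρ : ∀ j, ρ (ι' j) = ι (ρ j)) {F : J → ℝ} {F' : J' → ℝ}
    (hF' : ∀ j, 0 < F' j) (h : ∀ j, F j = ∑ k with ρ k = j, F' k) :
    ∑ j, (F j - F (ι j)) ^ 2 / (F j + F (ι j)) ≤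
      ∑ k, (F' k - F' (ι' k)) ^ 2 / (F' k + F' (ι' k)) := by
  rw [← Finset.sum_fiberwise (s := Finset.univ) (g := ρ)]
  refine Finset.sum_le_sum fun j _ => ?_
  -- The involution `ι'` carries the fiber over `j` onto the fiber over `ι j`.
  have h1 : F (ι j) = ∑ k with ρ k = j, F' (ι' k) := by
    rw [h]
    refine Finset.sum_nbij' ι' ι' ?_ ?_ (fun k _ => hι' k) (fun k _ => hι' k) ?_
    · intro k hk
      simp only [Finset.mem_filter, Finset.mem_univ, true_and] at hk ⊢
      rw [hρ, hk, hι]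
    · intro k hk
      simp only [Finset.mem_filter, Finset.mem_univ, true_and] at hk ⊢
      rw [hρ, hk]
    · intro k _
      rw [hι']
  rw [h1, h j, ← Finset.sum_sub_distrib, ← Finset.sum_add_distrib]
  exact Finset.sq_sum_div_le_sum_sq_div _ _ fun k _ => add_pos (hF' _) (hF' _)

/-- If the entropies `H n` take equal values at the end points of an interval, and their derivatives
are bounded by `-W n / E` up to the geometric mean of `W n - W (n - 1)` and a multiple of `n`, then
the integrals of the `W n` vanish. -/
theorem integral_eq_zero_of_forall_deriv_le {W H H' : ℕ → ℝ → ℝ} {a b E A : ℝ} (hab : a < b)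
    (hE : 0 < E) (hA : 0 < A) (hWc : ∀ n, ContinuousOn (W n) (Set.Icc a b))
    (hW0 : ∀ n, ∀ t ∈ Set.Icc a b, 0 ≤ W n t)
    (hWmono : ∀ n, ∀ t ∈ Set.Icc a b, W n t ≤ W (n + 1) t)
    (hH : ∀ n, ∀ t ∈ Set.Icc a b, HasDerivAt (H n) (H' n t) t) (hper : ∀ n, H n b = H n a)
    (hle : ∀ (n : ℕ) (l : ℝ), 0 < l → ∀ t ∈ Set.Icc a b, H' (n + 1) t ≤
      (-W (n + 1) t / E + (l * (A * (n + 2) * (W (n + 1) t - W n t)) + l⁻¹) / 2) / 2) (n : ℕ) :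
    ∫ t in a..b, W n t = 0 := by
  have hWi : ∀ n, IntervalIntegrable (W n) volume a b := fun n =>
    (hWc n).intervalIntegrable_of_Icc hab.le
  have hba : 0 < b - a := sub_pos.2 hab
  revert n
  refine eq_zero_of_sq_le_mul_sub (K := E ^ 2 * (b - a) * A) (by positivity)
    (fun n => intervalIntegral.integral_nonneg hab.le (hW0 n)) fun n => ?_
  have hX : 0 ≤ (∫ t in a..b, W (n + 1) t) - ∫ t in a..b, W n t :=
    sub_nonneg.2 (intervalIntegral.integral_mono_on hab.le (hWi _) (hWi _) (hWmono n))
  rw [mul_assoc (E ^ 2 * (b - a)) A]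
  -- Since `l` does not depend on time, the bound is linear in the `W n` and can be integrated.
  -- Optimising `l` afterwards does the work of Cauchy-Schwarz in time.
  refine le_mul_of_forall_le (intervalIntegral.integral_nonneg hab.le (hW0 _)) hE hba
    (by positivity) fun l hl => ?_
  have hφ : ∀ t, (-W (n + 1) t / E + (l * (A * (n + 2) * (W (n + 1) t - W n t)) + l⁻¹) / 2) / 2 =
      (-(2 * E)⁻¹ + l * (A * (n + 2)) / 4) * W (n + 1) t - l * (A * (n + 2)) / 4 * W n t +
        l⁻¹ / 4 := by
    intro t
    field_simp
    ring
  have hent := intervalIntegral.sub_le_integral_of_hasDeriv_right_of_le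
    (φ := fun t => (-(2 * E)⁻¹ + l * (A * (n + 2)) / 4) * W (n + 1) t -
      l * (A * (n + 2)) / 4 * W n t + l⁻¹ / 4) hab.le
    (fun t ht => (hH (n + 1) t ht).continuousAt.continuousWithinAt)
    (fun t ht => (hH (n + 1) t (Set.Ioo_subset_Icc_self ht)).hasDerivWithinAt)
    (((((hWc (n + 1)).const_mul _).sub ((hWc n).const_mul _)).add
      continuousOn_const).integrableOn_Icc)
    (fun t ht => (hle n l hl t (Set.Ioo_subset_Icc_self ht)).trans_eq (hφ t))
  rw [hper, sub_self, intervalIntegral.integral_add (((hWi _).const_mul _).sub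
    ((hWi _).const_mul _)) intervalIntegrable_const, intervalIntegral.integral_sub
    ((hWi _).const_mul _) ((hWi _).const_mul _), intervalIntegral.integral_const_mul,
    intervalIntegral.integral_const_mul, intervalIntegral.integral_const, smul_eq_mul] at hent
  have h2 : (∫ t in a..b, W (n + 1) t) / E ≤ (l * (A * (n + 2) *
      ((∫ t in a..b, W (n + 1) t) - ∫ t in a..b, W n t)) + (b - a) * l⁻¹) / 2 := by
    have h3 : (2 * E)⁻¹ * (∫ t in a..b, W (n + 1) t) = (∫ t in a..b, W (n + 1) t) / E / 2 := by
      field_simp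
    linarith
  rw [div_le_iff₀ hE] at h2
  linarith

variable {d q : ℕ}

/-! ### Cylinder functions, masses and flows -/

/-- The indicator of the cylinder of configurations whose restriction to `Λ` is `σ`. -/
noncomputable def ind (Λ : Finset (Fin d → ℤ)) (σ : Λ → Fin q) : C(Config d q, ℝ) where
  toFun ω := if Λ.restrict ω = σ then 1 else 0
  continuous_toFun :=
    (continuous_of_discreteTopology (f := fun τ : Λ → Fin q => if τ = σ then (1 : ℝ) else 0)).comp
      (Finset.continuous_restrict Λ)

theorem ind_apply (Λ : Finset (Fin d → ℤ)) (σ : Λ → Fin q) (ω : Config d q) :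
    ind Λ σ ω = if Λ.restrict ω = σ then 1 else 0 := rfl

theorem ind_nonneg (Λ : Finset (Fin d → ℤ)) (σ : Λ → Fin q) (ω : Config d q) :
    0 ≤ ind Λ σ ω := by
  rw [ind_apply]; split_ifs <;> norm_num

theorem sum_ind (Λ : Finset (Fin d → ℤ)) (ω : Config d q) : ∑ σ, ind Λ σ ω = 1 := by
  simp [ind_apply]

theorem ind_eq_sum_fiber {Λ Λ' : Finset (Fin d → ℤ)} (h : Λ ⊆ Λ') (σ : Λ → Fin q)
    (ω : Config d q) :
    ind Λ σ ω = ∑ τ : Λ' → Fin q with Finset.restrict₂ (π := fun _ => Fin q) h τ = σ, ind Λ' τ ω := by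
  simp only [ind_apply, Finset.sum_ite_eq, Finset.mem_filter, Finset.mem_univ, true_and]
  rfl

theorem restrict_update {Λ : Finset (Fin d → ℤ)} (x : Λ) (ω : Config d q) (i : Fin q) :
    Λ.restrict (Function.update ω x i) = Function.update (Λ.restrict ω) x i := by
  ext z
  by_cases hz : z = x
  · subst hz; simp
  · have : (z : Fin d → ℤ) ≠ x := fun h => hz (Subtype.ext h)
    simp [hz, this]

theorem restrict_update_of_notMem {Λ : Finset (Fin d → ℤ)} {x : Fin d → ℤ} (hx : x ∉ Λ)
    (ω : Config d q) (i : Fin q) :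
    Λ.restrict (Function.update ω x i) = Λ.restrict ω := by
  ext z
  have : (z : Fin d → ℤ) ≠ x := fun h => hx (h ▸ z.2)
  simp [this]

/-- A jump of the spin at x to σ x enters the cylinder exactly when the configuration agrees with σ
on Λ off x, whatever its spin j at x. Gains of a cylinder thus become flows out of its neighbours.
-/
theorem ind_update {Λ : Finset (Fin d → ℤ)} (σ : Λ → Fin q) (x : Λ) (ω : Config d q) (i : Fin q) :
    ind Λ σ (Function.update ω x i) =
      if i = σ x then ∑ j, ind Λ (Function.update σ x j) ω else 0 := by
  simp only [ind_apply, restrict_update]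
  split_ifs with h1 h2 h2
  · have : ∀ j, (Λ.restrict ω = Function.update σ x j) ↔ j = ω x := by
      intro j
      constructor
      · intro h
        have := congrFun h x
        simpa using this.symm
      · rintro rfl
        rw [← h1]
        simp only [Function.update_idem]
        exact (Function.update_eq_self x (Λ.restrict ω)).symm
    simp [this]
  · exact absurd (by simpa using congrFun h1 x) h2
  · symm
    apply Finset.sum_eq_zero
    intro j _
    rw [if_neg]
    intro h
    apply h1
    rw [h, h2]
    simp
  · rfl

theorem integrable_continuousMap (m : Measure (Config d q)) [IsFiniteMeasure m]
    (f : C(Config d q, ℝ)) : Integrable (fun ω => f ω) m :=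
  (BoundedContinuousFunction.mkOfCompact f).integrable _

/-- The mass of the cylinder `σ`. -/
noncomputable def mass (m : Measure (Config d q)) (Λ : Finset (Fin d → ℤ)) (σ : Λ → Fin q) : ℝ :=
  ∫ ω, ind Λ σ ω ∂m

/-- The rate at which mass flows out of the cylinder `σ` by jumps of the spin at `x` to `i`. -/
noncomputable def flow (r : (Fin d → ℤ) → Fin q → C(Config d q, ℝ)) (m : Measure (Config d q))
    (Λ : Finset (Fin d → ℤ)) (σ : Λ → Fin q) (x : Fin d → ℤ) (i : Fin q) : ℝ :=
  ∫ ω, (ind Λ σ * r x i) ω ∂m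

/-- The generator applied to the indicator of a cylinder. -/
noncomputable def genInd (r : (Fin d → ℤ) → Fin q → C(Config d q, ℝ))
    (Λ : Finset (Fin d → ℤ)) (σ : Λ → Fin q) : C(Config d q, ℝ) :=
  ∑ x : Λ, ∑ i, (ind Λ (Function.update σ x i) * r x (σ x) - ind Λ σ * r x i)

theorem genInd_apply (r : (Fin d → ℤ) → Fin q → C(Config d q, ℝ))
    (Λ : Finset (Fin d → ℤ)) (σ : Λ → Fin q) (ω : Config d q) :
    genInd r Λ σ ω =
      ∑ x : Λ, ∑ i, r x i ω * (ind Λ σ (Function.update ω x i) - ind Λ σ ω) := by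
  simp only [genInd, ContinuousMap.coe_sum, Finset.sum_apply, ContinuousMap.sub_apply,
    ContinuousMap.mul_apply, mul_sub, Finset.sum_sub_distrib, ind_update, mul_ite, mul_zero,
    Finset.sum_ite_eq', Finset.mem_univ, if_true, ← Finset.sum_mul]
  refine congrArg₂ _ (Finset.sum_congr rfl fun x _ => mul_comm _ _) ?_
  simp only [mul_comm _ (ind Λ σ ω), Finset.mul_sum]

theorem ind_mem_preGeneratorGraph (r : (Fin d → ℤ) → Fin q → C(Config d q, ℝ))
    (Λ : Finset (Fin d → ℤ)) (σ : Λ → Fin q) :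
    (ind Λ σ, genInd r Λ σ) ∈ preGeneratorGraph fun x η i => r x i η := by
  have hout : ∀ x ∉ Λ, ∀ (ω : Config d q) i, ind Λ σ (Function.update ω x i) = ind Λ σ ω := by
    intro x hx ω i
    rw [ind_apply, restrict_update_of_notMem hx, ind_apply]
  constructor
  · have h0 : ∀ x ∉ Λ, osc x (ind Λ σ) = 0 := by
      intro x hx
      simp only [osc, ENNReal.iSup_eq_zero]
      intro η ξ h
      have : Λ.restrict η = Λ.restrict ξ := by
        funext z
        exact h z fun e => hx (e ▸ z.2)
      simp [ind_apply, this]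
    have h1 : ∀ x, osc x (ind Λ σ) ≤ 1 := by
      intro x
      refine iSup_le fun η => iSup_le fun ξ => iSup_le fun _ => ?_
      rw [← ENNReal.ofReal_one]
      apply ENNReal.ofReal_le_ofReal
      simp only [ind_apply]
      split_ifs <;> norm_num
    show ∑' x, osc x (ind Λ σ) < ⊤
    rw [tsum_eq_sum (s := Λ) fun x hx => h0 x hx]
    exact ENNReal.sum_lt_top.2 fun x _ => (h1 x).trans_lt ENNReal.one_lt_top
  · intro ω
    show HasSum (fun x => ∑ i, r x i ω * (ind Λ σ (Function.update ω x i) - ind Λ σ ω))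
      (genInd r Λ σ ω)
    rw [genInd_apply, Finset.sum_coe_sort Λ
      (fun x => ∑ i, r x i ω * (ind Λ σ (Function.update ω x i) - ind Λ σ ω))]
    apply hasSum_sum_of_ne_finset_zero
    intro x hx
    simp [hout x hx]

/-! ### Masses and flows as integrals over cylinders. -/

section Bounds

variable (r : (Fin d → ℤ) → Fin q → C(Config d q, ℝ)) (m : Measure (Config d q))
  (Λ : Finset (Fin d → ℤ))

theorem mass_nonneg (σ : Λ → Fin q) : 0 ≤ mass m Λ σ :=
  integral_nonneg fun ω => ind_nonneg Λ σ ω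

variable [IsProbabilityMeasure m]

theorem integral_genInd (σ : Λ → Fin q) :
    ∫ ω, genInd r Λ σ ω ∂m = ∑ x : Λ, ∑ i,
      (flow r m Λ (Function.update σ x i) x (σ x) - flow r m Λ σ x i) := by
  have hint := integrable_continuousMap m
  simp only [genInd, ContinuousMap.coe_sum, Finset.sum_apply, ContinuousMap.sub_apply]
  rw [integral_finsetSum]
  · refine Finset.sum_congr rfl fun x _ => ?_
    rw [integral_finsetSum]
    · exact Finset.sum_congr rfl fun i _ => integral_sub (hint _) (hint _)
    · exact fun i _ => (hint _).sub (hint _)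
  · exact fun x _ => integrable_finsetSum _ fun i _ => (hint _).sub (hint _)

theorem sum_mass : ∑ σ, mass m Λ σ = 1 := by
  simp only [mass]
  rw [← integral_finsetSum _ fun σ _ => integrable_continuousMap m _]
  simp [sum_ind]

/-- Additivity of flows under refinement of the volume; it makes the dissipation monotone. -/
theorem flow_eq_sum_fiber {Λ' : Finset (Fin d → ℤ)} (h : Λ ⊆ Λ') (σ : Λ → Fin q)
    (x : Fin d → ℤ) (i : Fin q) :
    flow r m Λ σ x i = ∑ τ : Λ' → Fin q with Finset.restrict₂ (π := fun _ => Fin q) h τ = σ, flow r m Λ' τ x i := by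
  simp only [flow]
  rw [← integral_finsetSum _ fun σ _ => integrable_continuousMap m _]
  refine integral_congr_ae (Eventually.of_forall fun ω => ?_)
  simp only [ContinuousMap.mul_apply, ← Finset.sum_mul, ← ind_eq_sum_fiber h]

theorem abs_flow_sub_le (σ : Λ → Fin q) (x : Fin d → ℤ) (i : Fin q) {a ε : ℝ}
    (h : ∀ ω, Λ.restrict ω = σ → |r x i ω - a| ≤ ε) :
    |flow r m Λ σ x i - a * mass m Λ σ| ≤ ε * mass m Λ σ := by
  have e1 : flow r m Λ σ x i - a * mass m Λ σ = ∫ ω, (ind Λ σ * r x i) ω - a * ind Λ σ ω ∂m := by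
    rw [integral_sub (integrable_continuousMap m _)
      ((integrable_continuousMap m _).const_mul a), integral_const_mul]
    rfl
  rw [e1, mass, ← integral_const_mul]
  refine abs_integral_le_integral_abs.trans (integral_mono_of_nonneg
    (Eventually.of_forall fun ω => abs_nonneg _) ((integrable_continuousMap m _).const_mul ε)
    (Eventually.of_forall fun ω => ?_))
  simp only [ContinuousMap.mul_apply, ind_apply]
  split_ifs with hω
  · simpa using h ω hω
  · simp

theorem le_flow {δ : ℝ} (h : ∀ x i ω, δ ≤ r x i ω) (σ : Λ → Fin q) (x : Fin d → ℤ) (i : Fin q) :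
    δ * mass m Λ σ ≤ flow r m Λ σ x i := by
  rw [mass, ← integral_const_mul]
  refine integral_mono ((integrable_continuousMap m _).const_mul δ) (integrable_continuousMap m _)
    fun ω => ?_
  simp only [ContinuousMap.mul_apply, mul_comm δ]
  exact mul_le_mul_of_nonneg_left (h x i ω) (ind_nonneg Λ σ ω)

theorem flow_le {C : ℝ} (h : ∀ x i ω, r x i ω ≤ C) (σ : Λ → Fin q) (x : Fin d → ℤ) (i : Fin q) :
    flow r m Λ σ x i ≤ C * mass m Λ σ := by
  rw [mass, ← integral_const_mul]
  refine integral_mono (integrable_continuousMap m _) ((integrable_continuousMap m _).const_mul C)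
    fun ω => ?_
  simp only [ContinuousMap.mul_apply, mul_comm C]
  exact mul_le_mul_of_nonneg_left (h x i ω) (ind_nonneg Λ σ ω)

end Bounds

/-! ### Evolution of expectations -/

/-- Integration against a probability measure as a continuous linear functional. -/
noncomputable def integralCLM (m : Measure (Config d q)) [IsProbabilityMeasure m] :
    C(Config d q, ℝ) →L[ℝ] ℝ :=
  LinearMap.mkContinuous
    { toFun := fun f => ∫ ω, f ω ∂m
      map_add' := fun f g =>
        integral_add (integrable_continuousMap m f) (integrable_continuousMap m g)
      map_smul' := fun a f => integral_smul a fun ω => f ω } 1 fun f => by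
    have := norm_integral_le_of_norm_le_const (μ := m) (f := fun ω => f ω) (C := ‖f‖)
      (Eventually.of_forall fun ω => f.norm_coe_le_norm ω)
    simpa using this

namespace MarkovSemigroup

variable (S : MarkovSemigroup d q) (ν : ProbabilityMeasure (Config d q))

/-- The evolved measure at a real time; negative times are sent to `0`. -/
noncomputable def law (t : ℝ) : Measure (Config d q) :=
  (S.evolve ν t.toNNReal : Measure (Config d q))

instance (t : ℝ) : IsProbabilityMeasure (S.law ν t) :=
  inferInstanceAs (IsProbabilityMeasure (S.evolve ν t.toNNReal : Measure (Config d q)))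

theorem integral_law (t : ℝ) (f : C(Config d q, ℝ)) :
    ∫ ω, f ω ∂(S.law ν t) = integralCLM (ν : Measure (Config d q)) (S.P t.toNNReal f) :=
  S.integral_evolve ν _ f

theorem continuous_integral_law (f : C(Config d q, ℝ)) :
    Continuous fun t => ∫ ω, f ω ∂(S.law ν t) := by
  simp only [integral_law]
  exact (integralCLM _).continuous.comp ((S.continuous f).comp continuous_real_toNNReal)

/-- The generator limit is one-sided, so only a right derivative comes directly from P_{t+s} f - P_t
f = P_t (P_s f - f). -/
theorem hasDerivWithinAt_integral_law {f g : C(Config d q, ℝ)} (h : (f, g) ∈ S.generatorGraph)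
    {t : ℝ} (ht : 0 ≤ t) :
    HasDerivWithinAt (fun t => ∫ ω, f ω ∂(S.law ν t)) (∫ ω, g ω ∂(S.law ν t)) (Set.Ioi t) t := by
  rw [hasDerivWithinAt_iff_tendsto_slope' Set.self_notMem_Ioi]
  have h1 : Tendsto (fun s : ℝ≥0 => integralCLM (ν : Measure (Config d q))
      (S.P t.toNNReal ((s : ℝ)⁻¹ • (S.P s f - f)))) (𝓝[>] 0) (𝓝 (∫ ω, g ω ∂(S.law ν t))) := by
    rw [integral_law]
    exact (((integralCLM _).comp (S.P t.toNNReal)).continuous.tendsto g).comp h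
  have h2 : Tendsto (fun s : ℝ => (s - t).toNNReal) (𝓝[>] t) (𝓝[>] 0) := by
    apply tendsto_nhdsWithin_of_tendsto_nhds_of_eventually_within
    · have : Continuous fun s : ℝ => (s - t).toNNReal := by fun_prop
      have h3 := (this.tendsto t).mono_left (nhdsWithin_le_nhds (s := Set.Ioi t))
      simpa using h3
    · filter_upwards [self_mem_nhdsWithin] with s hs
      simpa using hs
  refine (h1.comp h2).congr' ?_
  filter_upwards [self_mem_nhdsWithin] with s hs
  have hs' : t < s := hs
  have e1 : s.toNNReal = t.toNNReal + (s - t).toNNReal := by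
    rw [← Real.toNNReal_add ht (by linarith)]; congr 1; ring
  have e2 : ((s - t).toNNReal : ℝ) = s - t := Real.coe_toNNReal _ (by linarith)
  simp only [Function.comp, slope, integral_law, vsub_eq_sub, e1, S.add, map_smul, map_sub, e2]

/-- The right derivative is continuous in time, so the expectation is its integral and hence
differentiable from both sides at positive times. -/
theorem hasDerivAt_integral_law {f g : C(Config d q, ℝ)} (h : (f, g) ∈ S.generatorGraph)
    {t : ℝ} (ht : 0 < t) :
    HasDerivAt (fun t => ∫ ω, f ω ∂(S.law ν t)) (∫ ω, g ω ∂(S.law ν t)) t := by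
  have hv := S.continuous_integral_law ν g
  have key : ∀ s, 0 ≤ s → ∫ ω, f ω ∂(S.law ν s) =
      (∫ ω, f ω ∂(S.law ν 0)) + ∫ u in (0 : ℝ)..s, ∫ ω, g ω ∂(S.law ν u) := by
    intro s hs
    rw [intervalIntegral.integral_eq_sub_of_hasDeriv_right_of_le hs
      (S.continuous_integral_law ν f).continuousOn
      (fun u hu => S.hasDerivWithinAt_integral_law ν h hu.1.le) (hv.intervalIntegrable _ _)]
    ring
  have h1 : HasDerivAt (fun s : ℝ => (∫ ω, f ω ∂(S.law ν 0)) +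
      ∫ u in (0 : ℝ)..s, ∫ ω, g ω ∂(S.law ν u)) (∫ ω, g ω ∂(S.law ν t)) t :=
    (intervalIntegral.integral_hasDerivAt_right (hv.intervalIntegrable _ _)
      (hv.stronglyMeasurableAtFilter _ _) hv.continuousAt).const_add _
  refine h1.congr_of_eventuallyEq ?_
  filter_upwards [lt_mem_nhds ht] with s hs using key s hs.le

variable {S} {r : (Fin d → ℤ) → Fin q → C(Config d q, ℝ)}

theorem IsGeneratedBy.ind_mem (hS : S.IsGeneratedBy fun x η i => r x i η)
    (Λ : Finset (Fin d → ℤ)) (σ : Λ → Fin q) : (ind Λ σ, genInd r Λ σ) ∈ S.generatorGraph := by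
  rw [hS]
  exact subset_closure (ind_mem_preGeneratorGraph r Λ σ)

theorem IsGeneratedBy.hasDerivAt_mass (hS : S.IsGeneratedBy fun x η i => r x i η)
    (Λ : Finset (Fin d → ℤ)) (σ : Λ → Fin q) {t : ℝ} (ht : 0 < t) :
    HasDerivAt (fun t => mass (S.law ν t) Λ σ) (∑ x : Λ, ∑ i,
      (flow r (S.law ν t) Λ (Function.update σ x i) x (σ x) - flow r (S.law ν t) Λ σ x i)) t := by
  rw [← integral_genInd]
  exact S.hasDerivAt_integral_law ν (hS.ind_mem Λ σ) ht

theorem continuous_flow (Λ : Finset (Fin d → ℤ)) (σ : Λ → Fin q) (x : Fin d → ℤ) (i : Fin q) :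
    Continuous fun t => flow r (S.law ν t) Λ σ x i :=
  S.continuous_integral_law ν _

/-- With positive rates, every cylinder has positive mass at positive times. -/
theorem IsGeneratedBy.mass_pos (hS : S.IsGeneratedBy fun x η i => r x i η) {δ : ℝ} (hδ : 0 < δ)
    (hr : ∀ x i ω, δ ≤ r x i ω) {C : ℝ} (hC : ∀ x i ω, r x i ω ≤ C)
    (Λ : Finset (Fin d → ℤ)) (σ : Λ → Fin q) {t : ℝ} (ht : 0 < t) :
    0 < mass (S.law ν t) Λ σ := by
  set m := S.law ν t with hm
  have hflow0 : ∀ σ x i, 0 ≤ flow r m Λ σ x i := fun σ x i =>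
    (mul_nonneg hδ.le (mass_nonneg m Λ σ)).trans (le_flow r m Λ hr σ x i)
  have step : ∀ σ, mass m Λ σ = 0 → ∀ x i, mass m Λ (Function.update σ x i) = 0 := by
    intro σ hσ x i
    -- A vanishing mass is a minimum in time, so its derivative is zero. The outflow vanishes with
    -- the mass, hence so does every inflow, and positive rates force zero mass on the neighbouring
    -- cylinders.
    have hmin : IsLocalMin (fun t => mass (S.law ν t) Λ σ) t :=
      Eventually.of_forall fun s => by
        show mass m Λ σ ≤ mass (S.law ν s) Λ σ
        rw [hσ]; exact mass_nonneg _ Λ σ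
    have hz := hmin.hasDerivAt_eq_zero (hS.hasDerivAt_mass ν Λ σ ht)
    rw [← hm] at hz
    have hF : ∀ x i, flow r m Λ σ x i = 0 := by
      intro x i
      have := flow_le r m Λ hC σ x i
      rw [hσ, mul_zero] at this
      exact le_antisymm this (hflow0 _ _ _)
    simp only [hF, sub_zero] at hz
    rw [Finset.sum_eq_zero_iff_of_nonneg fun x _ => Finset.sum_nonneg fun i _ => hflow0 _ _ _] at hz
    have h2 := hz x (Finset.mem_univ _)
    rw [Finset.sum_eq_zero_iff_of_nonneg fun i _ => hflow0 _ _ _] at h2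
    have h3 := h2 i (Finset.mem_univ _)
    have h4 := le_flow r m Λ hr (Function.update σ x i) x (σ x)
    rw [h3] at h4
    exact le_antisymm (nonpos_of_mul_nonpos_right h4 hδ) (mass_nonneg _ _ _)
  refine lt_of_le_of_ne (mass_nonneg _ _ _) fun h0 => ?_
  have hall : ∀ τ, mass m Λ τ = 0 := by
    intro τ
    -- Changing one spin at a time, zero mass spreads to all cylinders over Λ, although the masses
    -- add up to 1.
    have : ∀ s : Finset Λ, mass m Λ (s.piecewise τ σ) = 0 := by
      intro s
      induction s using Finset.induction_on with
      | empty => simpa using h0.symm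
      | insert a s _ ih =>
        rw [Finset.piecewise_insert]
        exact step _ ih _ _
    have h1 := this Finset.univ
    rwa [Finset.piecewise_univ] at h1
  have := sum_mass m Λ
  simp [hall] at this

/-! ### Reversible measures -/

theorem IsReversible.evolve_eq {μ : ProbabilityMeasure (Config d q)} (h : S.IsReversible μ)
    (t : ℝ≥0) : S.evolve μ t = μ := by
  symm
  apply S.evolve_unique
  intro f
  have := h t 1 f
  rw [S.one] at this
  simpa using this.symm

/-- The symmetry of the generator is the derivative at time 0 of the symmetry of the semigroup. -/
theorem IsReversible.integral_mul_comm {μ : ProbabilityMeasure (Config d q)}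
    (h : S.IsReversible μ) {f f' g g' : C(Config d q, ℝ)} (hf : (f, f') ∈ S.generatorGraph)
    (hg : (g, g') ∈ S.generatorGraph) :
    ∫ ω, (f * g') ω ∂(μ : Measure (Config d q)) = ∫ ω, (g * f') ω ∂(μ : Measure (Config d q)) := by
  have key : ∀ {f g g' : C(Config d q, ℝ)}, (g, g') ∈ S.generatorGraph →
      Tendsto (fun t : ℝ≥0 => (t : ℝ)⁻¹ * ((∫ ω, f ω * S.P t g ω ∂(μ : Measure (Config d q))) -
        ∫ ω, (f * g) ω ∂(μ : Measure (Config d q)))) (𝓝[>] 0)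
        (𝓝 (∫ ω, (f * g') ω ∂(μ : Measure (Config d q)))) := by
    intro f g g' hg
    have hcont : Continuous fun k : C(Config d q, ℝ) =>
        integralCLM (μ : Measure (Config d q)) (f * k) :=
      (integralCLM _).continuous.comp (continuous_const.mul continuous_id)
    refine ((hcont.tendsto g').comp hg).congr fun t => ?_
    show integralCLM (μ : Measure (Config d q)) (f * ((t : ℝ)⁻¹ • (S.P t g - g))) = _
    rw [mul_smul_comm, map_smul, mul_sub, map_sub]
    rfl
  have h1 := key (f := f) hg
  have h2 := key (f := g) hf
  refine tendsto_nhds_unique h1 (h2.congr fun t => ?_)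
  rw [h t f g, mul_comm f g]

/-- Detailed balance. -/
theorem IsReversible.flow_eq (hS : S.IsGeneratedBy fun x η i => r x i η)
    {μ : ProbabilityMeasure (Config d q)} (h : S.IsReversible μ)
    (Λ : Finset (Fin d → ℤ)) (σ : Λ → Fin q) (x : Λ) (i : Fin q) :
    flow r (μ : Measure (Config d q)) Λ (Function.update σ x i) x (σ x) =
      flow r (μ : Measure (Config d q)) Λ σ x i := by
  by_cases hi : i = σ x
  · subst hi; simp
  -- From the cylinder σ, the only single jump into the cylinder of σ with spin i at x is the jump
  -- at x to i. Symmetry of the generator for the two indicators then reads as detailed balance.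
  have key : ∀ (σ : Λ → Fin q) (i : Fin q), i ≠ σ x →
      ind Λ σ * genInd r Λ (Function.update σ x i) = ind Λ σ * r x i := by
    intro σ i hi
    ext ω
    simp only [ContinuousMap.mul_apply]
    by_cases hω : Λ.restrict ω = σ
    · congr 1
      have h0 : ind Λ (Function.update σ x i) ω = 0 := by
        rw [ind_apply, if_neg]
        intro h
        have := congrFun (hω.symm.trans h) x
        rw [Function.update_self] at this
        exact hi this.symm
      simp only [genInd_apply, h0, sub_zero, ind_apply, restrict_update, hω]
      rw [Finset.sum_eq_single x, Finset.sum_eq_single i]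
      · simp
      · intro j _ hj
        rw [if_neg, mul_zero]
        intro h
        exact hj (by simpa using congrFun h x)
      · simp
      · intro y _ hy
        apply Finset.sum_eq_zero
        intro j _
        rw [if_neg, mul_zero]
        intro h
        have := congrFun h x
        rw [Function.update_of_ne hy.symm, Function.update_self] at this
        exact hi this.symm
      · simp
    · simp [ind_apply, hω]
  have h1 := h.integral_mul_comm (hS.ind_mem Λ σ) (hS.ind_mem Λ (Function.update σ x i))
  rw [key σ i hi] at h1
  have h2 := key (Function.update σ x i) (σ x) (by simpa using Ne.symm hi)
  rw [Function.update_idem, Function.update_eq_self] at h2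
  rw [h2] at h1
  exact h1.symm

end MarkovSemigroup

section Dissipation

/-! ### Entropy production in a finite volume -/

/-- The jump reversing a jump at `x`. -/
def reverse {Λ : Finset (Fin d → ℤ)} (x : Λ) (j : (Λ → Fin q) × Fin q) : (Λ → Fin q) × Fin q :=
  (Function.update j.1 x j.2, j.1 x)

theorem reverse_involutive {Λ : Finset (Fin d → ℤ)} (x : Λ) :
    Function.Involutive (reverse (q := q) x) := by
  rintro ⟨σ, i⟩
  simp [reverse]

/-- The dissipation at the site `x`, measuring how far the flow at `x` is from detailed balance. -/
noncomputable def dissipation (r : (Fin d → ℤ) → Fin q → C(Config d q, ℝ))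
    (m : Measure (Config d q)) (Λ : Finset (Fin d → ℤ)) (x : Λ) : ℝ :=
  ∑ j : (Λ → Fin q) × Fin q,
    (flow r m Λ j.1 x j.2 - flow r m Λ (reverse x j).1 x (reverse x j).2) ^ 2 /
      (flow r m Λ j.1 x j.2 + flow r m Λ (reverse x j).1 x (reverse x j).2)

variable {r : (Fin d → ℤ) → Fin q → C(Config d q, ℝ)} {m : Measure (Config d q)}

theorem dissipation_nonneg {Λ : Finset (Fin d → ℤ)} (hpos : ∀ σ x i, 0 < flow r m Λ σ x i)
    (x : Λ) : 0 ≤ dissipation r m Λ x :=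
  Finset.sum_nonneg fun _ _ => div_nonneg (sq_nonneg _) (add_pos (hpos _ _ _) (hpos _ _ _)).le

theorem flow_reverse_eq_of_dissipation_eq_zero {Λ : Finset (Fin d → ℤ)} {x : Λ}
    (hpos : ∀ σ x i, 0 < flow r m Λ σ x i)
    (h : dissipation r m Λ x = 0) (σ : Λ → Fin q) (i : Fin q) :
    flow r m Λ (Function.update σ x i) x (σ x) = flow r m Λ σ x i := by
  rw [dissipation, Finset.sum_eq_zero_iff_of_nonneg fun j _ =>
    div_nonneg (sq_nonneg _) (add_pos (hpos _ _ _) (hpos _ _ _)).le] at h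
  have h1 := h (σ, i) (Finset.mem_univ _)
  rw [div_eq_zero_iff, or_iff_left (add_pos (hpos _ _ _) (hpos _ _ _)).ne', sq_eq_zero_iff,
    sub_eq_zero] at h1
  exact h1.symm

variable [IsProbabilityMeasure m]

/-- Restricting jumps from Λ' to Λ commutes with reversal and adds up flows, so the coarse graining
inequality applies. -/
theorem dissipation_mono {Λ Λ' : Finset (Fin d → ℤ)} (h : Λ ⊆ Λ')
    (hpos : ∀ τ x i, 0 < flow r m Λ' τ x i) (x : Λ) :
    dissipation r m Λ x ≤ dissipation r m Λ' ⟨x, h x.2⟩ := by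
  have hρ : ∀ k, (Finset.restrict₂ (π := fun _ => Fin q) h (reverse ⟨x, h x.2⟩ k).1,
      (reverse ⟨x, h x.2⟩ k).2) =
      reverse x (Finset.restrict₂ (π := fun _ => Fin q) h k.1, k.2) := by
    rintro ⟨τ, i⟩
    refine Prod.ext ?_ rfl
    funext z
    simp only [reverse, Finset.restrict₂, Function.update_apply, Subtype.ext_iff]
  have hF : ∀ j : (Λ → Fin q) × Fin q, flow r m Λ j.1 x j.2 =
      ∑ k : (Λ' → Fin q) × Fin q with (Finset.restrict₂ (π := fun _ => Fin q) h k.1, k.2) = j,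
        flow r m Λ' k.1 x k.2 := by
    rintro ⟨σ, i⟩
    rw [flow_eq_sum_fiber r m Λ h]
    refine Finset.sum_nbij' (fun τ => (τ, i)) (fun k => k.1) ?_ ?_ ?_ ?_ ?_
    · intro τ; simp
    · rintro ⟨τ, k⟩; simp +contextual
    · intro τ; simp
    · rintro ⟨τ, k⟩; simp +contextual
    · intro τ; simp
  have key := sum_sq_div_le_of_fiber_sum (F := fun j => flow r m Λ j.1 x j.2)
    (F' := fun k => flow r m Λ' k.1 x k.2)
    (ρ := fun k => (Finset.restrict₂ (π := fun _ => Fin q) h k.1, k.2))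
    (reverse_involutive x) (reverse_involutive ⟨x, h x.2⟩) hρ (fun k => hpos k.1 x k.2)
    fun j => (hF j).trans (Finset.sum_congr (by congr) fun _ _ => rfl)
  rw [dissipation, dissipation]
  exact key

/-- The cylinders over Λ partition the space, so the total flow at x is the expected total jump rate
there. -/
theorem sum_flow_le {C : ℝ} (hC : ∀ x ω, ∑ i, r x i ω ≤ C) (Λ : Finset (Fin d → ℤ))
    (x : Fin d → ℤ) : ∑ j : (Λ → Fin q) × Fin q, flow r m Λ j.1 x j.2 ≤ C := by
  have hint := integrable_continuousMap m
  simp only [flow]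
  rw [← integral_finsetSum _ fun j _ => hint _]
  have h1 : ∀ ω, ∑ j : (Λ → Fin q) × Fin q, (ind Λ j.1 * r x j.2) ω ≤ C := by
    intro ω
    rw [Fintype.sum_prod_type]
    simp only [ContinuousMap.mul_apply, ← Finset.mul_sum]
    rw [← Finset.sum_mul, sum_ind, one_mul]
    exact hC x ω
  refine (integral_mono (integrable_finsetSum _ fun j _ => hint _) (integrable_const C) h1).trans ?_
  simp

/-- Flow divided by mass is an average of the rate over the cylinder. For both measures it is within
`ε` of the rate at one reference configuration and at least `δ`, where log is 1/δ-Lipschitz. -/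
theorem abs_log_flow_sub_le {μ : Measure (Config d q)} [IsProbabilityMeasure μ]
    {Λ : Finset (Fin d → ℤ)} {δ ε : ℝ} (hδ : 0 < δ) (hr : ∀ x i ω, δ ≤ r x i ω)
    (x : Λ) (σ : Λ → Fin q) (i : Fin q) (hm : 0 < mass m Λ σ) (hμ : 0 < mass μ Λ σ)
    (hε : ∀ ω ω', Λ.restrict ω = σ → Λ.restrict ω' = σ → |r x i ω - r x i ω'| ≤ ε) :
    |(Real.log (flow r m Λ σ x i) - Real.log (mass m Λ σ)) -
      (Real.log (flow r μ Λ σ x i) - Real.log (mass μ Λ σ))| ≤ 2 * ε / δ := by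
  obtain ⟨ω₁⟩ : Nonempty (Config d q) := nonempty_of_isProbabilityMeasure m
  let ω₀ : Config d q := fun z => if h : z ∈ Λ then σ ⟨z, h⟩ else ω₁ z
  have h0 : Λ.restrict ω₀ = σ := by
    funext z
    simp [ω₀]
  have key : ∀ (m' : Measure (Config d q)) [IsProbabilityMeasure m'], 0 < mass m' Λ σ →
      δ ≤ flow r m' Λ σ x i / mass m' Λ σ ∧
      |flow r m' Λ σ x i / mass m' Λ σ - r x i ω₀| ≤ ε := by
    intro m' _ hm'
    refine ⟨(le_div_iff₀ hm').2 (le_flow r m' Λ hr σ x i), ?_⟩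
    have h1 := abs_flow_sub_le r m' Λ σ x i (fun ω hω => hε ω ω₀ hω h0)
    rw [show flow r m' Λ σ x i / mass m' Λ σ - r x i ω₀ =
      (flow r m' Λ σ x i - r x i ω₀ * mass m' Λ σ) / mass m' Λ σ by field_simp, abs_div,
      abs_of_pos hm', div_le_iff₀ hm']
    exact h1
  obtain ⟨a1, a2⟩ := key m hm
  obtain ⟨b1, b2⟩ := key μ hμ
  have hfm : 0 < flow r m Λ σ x i := (mul_pos hδ hm).trans_le (le_flow r m Λ hr σ x i)
  have hfμ : 0 < flow r μ Λ σ x i := (mul_pos hδ hμ).trans_le (le_flow r μ Λ hr σ x i)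
  rw [← Real.log_div hfm.ne' hm.ne', ← Real.log_div hfμ.ne' hμ.ne']
  refine (abs_log_sub_log_le hδ a1 b1).trans ?_
  gcongr
  rw [abs_le] at a2 b2 ⊢
  constructor <;> linarith [a2.1, a2.2, b2.1, b2.2]

/-- The derivative of the relative entropy with respect to a reversible measure `μ`, in a finite
volume, is bounded by the dissipation up to boundary terms. -/
theorem entropy_production_le {μ : Measure (Config d q)} [IsProbabilityMeasure μ]
    {Λ : Finset (Fin d → ℤ)} {δ C : ℝ} (hδ : 0 < δ) (hr : ∀ x i ω, δ ≤ r x i ω)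
    (hC : ∀ x ω, ∑ i, r x i ω ≤ C)
    (hm : ∀ σ, 0 < mass m Λ σ) (hμ : ∀ σ, 0 < mass μ Λ σ)
    (hbal : ∀ (σ : Λ → Fin q) (x : Λ) (i : Fin q),
      flow r μ Λ (Function.update σ x i) x (σ x) = flow r μ Λ σ x i)
    {ε : Λ → ℝ} (hε0 : ∀ x, 0 ≤ ε x)
    (hε : ∀ (x : Λ) i ω ω', Λ.restrict ω = Λ.restrict ω' → ω x ≠ i →
      |r x i ω - r x i ω'| ≤ ε x) :
    ∑ σ, (∑ x : Λ, ∑ i, (flow r m Λ (Function.update σ x i) x (σ x) - flow r m Λ σ x i)) *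
        (Real.log (mass m Λ σ) - Real.log (mass μ Λ σ) + 1) ≤
      ∑ x : Λ, (-dissipation r m Λ x +
        4 * ε x / δ * √(2 * C * dissipation r m Λ x)) / 2 := by
  have hflow : ∀ (m' : Measure (Config d q)) [IsProbabilityMeasure m'],
      (∀ σ, 0 < mass m' Λ σ) → ∀ σ x i, 0 < flow r m' Λ σ x i := fun m' _ h σ x i =>
    (mul_pos hδ (h σ)).trans_le (le_flow r m' Λ hr σ x i)
  simp only [Finset.sum_mul]
  rw [Finset.sum_comm]
  refine Finset.sum_le_sum fun x _ => ?_
  -- The constant 1 in the potential cancels along jumps. The 4 in `κ` collects two errors 2 ε / δ,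
  -- one for a jump and one for its reversal.
  have h1 := sum_mul_le_of_involutive (reverse_involutive (q := q) x)
    (F := fun j => flow r m Λ j.1 x j.2)
    (g := fun j => Real.log (mass m Λ j.1) - Real.log (mass μ Λ j.1) + 1)
    (fun j => hflow m hm _ _ _) (κ := 4 * ε x / δ)
    (div_nonneg (mul_nonneg zero_le_four (hε0 x)) hδ.le) ?_ (sum_flow_le hC Λ x)
  · rw [Fintype.sum_prod_type] at h1
    exact h1
  · rintro ⟨σ, i⟩
    -- A jump to the present value is fixed by reversal; it must be set aside because `hε` does not
    -- control its rate.
    by_cases hi : i = σ x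
    · subst hi
      simp only [reverse, Function.update_eq_self, sub_self, abs_zero]
      exact div_nonneg (mul_nonneg zero_le_four (hε0 x)) hδ.le
    have hcmp : ∀ (σ : Λ → Fin q) (i : Fin q), i ≠ σ x →
        |(Real.log (flow r m Λ σ x i) - Real.log (mass m Λ σ)) -
          (Real.log (flow r μ Λ σ x i) - Real.log (mass μ Λ σ))| ≤ 2 * ε x / δ := by
      intro σ i hi
      refine abs_log_flow_sub_le hδ hr x σ i (hm σ) (hμ σ) fun ω ω' hω hω' => ?_
      refine hε x i ω ω' (hω.trans hω'.symm) ?_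
      rw [← hω] at hi
      exact hi.symm
    have c1 := hcmp σ i hi
    have c2 := hcmp (Function.update σ x i) (σ x) (by simpa using Ne.symm hi)
    rw [hbal] at c2
    simp only [reverse]
    have e : 4 * ε x / δ = 2 * ε x / δ + 2 * ε x / δ := by ring
    rw [abs_le] at c1 c2 ⊢
    constructor <;> linarith [c1.1, c1.2, c2.1, c2.2]

end Dissipation

/-! ### Boxes and the decay of the rates -/

/-- The sup norm of a lattice site, as a natural number. -/
def supNorm (x : Fin d → ℤ) : ℕ := Finset.univ.sup fun i => (x i).natAbs

theorem supNorm_le_iff {x : Fin d → ℤ} {n : ℕ} : supNorm x ≤ n ↔ ∀ i, (x i).natAbs ≤ n := by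
  simp [supNorm, Finset.sup_le_iff]

theorem supNorm_add_le (x y : Fin d → ℤ) : supNorm (x + y) ≤ supNorm x + supNorm y := by
  rw [supNorm_le_iff]
  intro i
  exact (Int.natAbs_add_le _ _).trans
    (add_le_add (supNorm_le_iff.1 le_rfl i) (supNorm_le_iff.1 le_rfl i))

theorem enorm_eq_supNorm (x : Fin d → ℤ) : ‖x‖ₑ = (supNorm x : ℝ≥0∞) := by
  have h : ‖x‖₊ = (supNorm x : ℝ≥0) := by
    apply le_antisymm
    · rw [pi_nnnorm_le_iff]
      intro i
      rw [← NNReal.natCast_natAbs]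
      exact_mod_cast supNorm_le_iff.1 le_rfl i
    · obtain h | h := (Finset.univ : Finset (Fin d)).eq_empty_or_nonempty
      · simp [supNorm, h]
      · obtain ⟨i, _, hi⟩ := Finset.exists_mem_eq_sup _ h fun i => (x i).natAbs
        rw [supNorm, hi, NNReal.natCast_natAbs]
        exact nnnorm_le_pi_nnnorm x i
  rw [enorm_eq_nnnorm, h]
  simp

/-- The box of sites of sup norm at most `n`. -/
noncomputable def box (d n : ℕ) : Finset (Fin d → ℤ) := Fintype.piFinset fun _ => Finset.Icc (-n : ℤ) n

theorem mem_box {n : ℕ} {x : Fin d → ℤ} : x ∈ box d n ↔ supNorm x ≤ n := by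
  rw [box, Fintype.mem_piFinset, supNorm_le_iff]
  refine forall_congr' fun i => ?_
  rw [Finset.mem_Icc]
  omega

theorem box_mono (d : ℕ) : Monotone (box d) := fun _ _ h _ hx => mem_box.2 ((mem_box.1 hx).trans h)

theorem card_box (d n : ℕ) : (box d n).card = (2 * n + 1) ^ d := by
  rw [box, Fintype.card_piFinset]
  simp only [Int.card_Icc, Finset.prod_const, Finset.card_univ, Fintype.card_fin]
  congr 1
  omega

/-- This linear growth of spheres is where the restriction on the dimension enters. -/
theorem card_shell_le (hd : d = 1 ∨ d = 2) (n k : ℕ) :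
    ((box d n).filter fun x => supNorm x = k).card ≤ 8 * (k + 1) := by
  have h1 : (box d n).filter (fun x => supNorm x = k) ⊆ (box d k).filter fun x => supNorm x = k :=
    fun x hx => by
      rw [Finset.mem_filter] at hx ⊢
      exact ⟨mem_box.2 hx.2.le, hx.2⟩
  refine (Finset.card_le_card h1).trans ?_
  cases k with
  | zero =>
    refine (Finset.card_filter_le _ _).trans ?_
    rw [card_box]
    simp
  | succ k =>
    have h2 : (box d (k + 1)).filter (fun x => supNorm x = k + 1) = box d (k + 1) \ box d k := by
      ext x
      simp only [Finset.mem_filter, Finset.mem_sdiff, mem_box]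
      omega
    rw [h2, Finset.card_sdiff_of_subset (box_mono d (Nat.le_succ k)), card_box, card_box]
    rcases hd with rfl | rfl
    · rw [pow_one, pow_one]; omega
    · rw [Nat.sub_le_iff_le_add]; nlinarith

theorem sum_box_le (hd : d = 1 ∨ d = 2) {e : ℕ → ℝ} (he0 : ∀ j, 0 ≤ e j) (he : Summable e) (n : ℕ) :
    ∑ x ∈ box d n, e (n - supNorm x) ≤ 8 * (n + 1) * ∑' j, e j := by
  have h1 : ∑ x ∈ box d n, e (n - supNorm x) =
      ∑ k ∈ Finset.range (n + 1), ∑ x ∈ box d n with supNorm x = k, e (n - supNorm x) := by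
    rw [Finset.sum_fiberwise_of_maps_to]
    intro x hx
    have := mem_box.1 hx
    simp; omega
  rw [h1]
  calc _ ≤ ∑ k ∈ Finset.range (n + 1), 8 * ((n : ℝ) + 1) * e (n - k) := by
        refine Finset.sum_le_sum fun k hk => ?_
        have h2 : ∑ x ∈ box d n with supNorm x = k, e (n - supNorm x) =
            ∑ x ∈ box d n with supNorm x = k, e (n - k) :=
          Finset.sum_congr rfl fun x hx => by rw [(Finset.mem_filter.1 hx).2]
        rw [h2, Finset.sum_const, nsmul_eq_mul]
        refine mul_le_mul_of_nonneg_right ?_ (he0 _)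
        have h3 : k ≤ n := by simp at hk; omega
        have h4 : ((box d n).filter fun x => supNorm x = k).card ≤ 8 * (n + 1) :=
          (card_shell_le hd n k).trans (by omega)
        exact_mod_cast h4
    _ = 8 * (n + 1) * ∑ j ∈ Finset.range (n + 1), e j := by
        rw [← Finset.mul_sum]
        congr 1
        have := Finset.sum_range_reflect e (n + 1)
        simpa using this
    _ ≤ _ := by
        gcongr
        exact he.sum_le_tsum _ fun j _ => he0 j

theorem ofReal_abs_sub_piecewise_le (f : Config d q → ℝ) (Λ s : Finset (Fin d → ℤ))
    {ω ω' : Config d q} (h : ∀ z ∈ Λ, ω z = ω' z) :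
    ENNReal.ofReal |f ω - f (s.piecewise ω' ω)| ≤ ∑ z ∈ s, if z ∈ Λ then 0 else osc z f := by
  induction s using Finset.induction_on with
  | empty => simp
  | insert a s ha ih =>
    rw [Finset.sum_insert ha, Finset.piecewise_insert]
    set ζ := s.piecewise ω' ω with hζ
    have h1 : ENNReal.ofReal |f ζ - f (Function.update ζ a (ω' a))| ≤
        if a ∈ Λ then 0 else osc a f := by
      split_ifs with haΛ
      · have : Function.update ζ a (ω' a) = ζ := by
          rw [Function.update_eq_self_iff, hζ, Finset.piecewise_eq_of_notMem _ _ _ ha, h a haΛ]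
        simp [this]
      · exact le_iSup_of_le ζ (le_iSup_of_le (Function.update ζ a (ω' a))
          (le_iSup_of_le (fun z hz => by rw [Function.update_of_ne hz]) le_rfl))
    calc ENNReal.ofReal |f ω - f (Function.update ζ a (ω' a))|
        ≤ ENNReal.ofReal (|f ω - f ζ| + |f ζ - f (Function.update ζ a (ω' a))|) :=
          ENNReal.ofReal_le_ofReal (abs_sub_le _ _ _)
      _ ≤ _ := ENNReal.ofReal_add_le
      _ ≤ _ := by rw [add_comm]; exact add_le_add h1 ih

/-- Spins are changed from ω to ω' one site at a time, at no cost inside Λ; continuity allows the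
finite set of changed sites to exhaust the lattice. -/
theorem ofReal_abs_sub_le_tsum {f : Config d q → ℝ} (hf : Continuous f)
    (Λ : Finset (Fin d → ℤ)) {ω ω' : Config d q} (h : ∀ z ∈ Λ, ω z = ω' z) :
    ENNReal.ofReal |f ω - f ω'| ≤ ∑' z, if z ∈ Λ then 0 else osc z f := by
  have h1 : Tendsto (fun s : Finset (Fin d → ℤ) => s.piecewise ω' ω) atTop (𝓝 ω') := by
    rw [tendsto_pi_nhds]
    intro z
    apply tendsto_const_nhds.congr'
    filter_upwards [eventually_ge_atTop {z}] with s hs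
    rw [Finset.piecewise_eq_of_mem _ _ _ (hs (Finset.mem_singleton_self z))]
  have h2 : Tendsto (fun s : Finset (Fin d → ℤ) => ENNReal.ofReal |f ω - f (s.piecewise ω' ω)|)
      atTop (𝓝 (ENNReal.ofReal |f ω - f ω'|)) :=
    ENNReal.tendsto_ofReal ((tendsto_const_nhds.sub ((hf.tendsto ω').comp h1)).abs)
  exact le_of_tendsto h2 (Eventually.of_forall fun s =>
    (ofReal_abs_sub_piecewise_le f Λ s h).trans (ENNReal.sum_le_tsum s))

/-- Each y is counted once for every j < |y|; the first moment in (R4) is thus exactly the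
summability of the tails. -/
theorem tsum_tsum_if_lt (α : (Fin d → ℤ) → ℝ≥0∞) :
    ∑' j : ℕ, ∑' y : Fin d → ℤ, (if j < supNorm y then α y else 0) = ∑' y, ‖y‖ₑ * α y := by
  rw [ENNReal.tsum_comm]
  refine tsum_congr fun y => ?_
  rw [tsum_eq_sum (s := Finset.range (supNorm y)) fun j hj => if_neg (by simpa using hj),
    Finset.sum_congr rfl fun j hj => if_pos (Finset.mem_range.1 hj), enorm_eq_supNorm]
  simp

/-! ### Decay and boundedness of the rates. -/

section Rates

variable {c : (Fin d → ℤ) → Config d q → Fin q → ℝ}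

/-- The influence on the rates at `x` of the configuration outside a box decays summably in the
distance of `x` to the complement of the box. -/
theorem RateAssumptions.exists_summable_bound (hc : RateAssumptions c) :
    ∃ e : ℕ → ℝ, Summable e ∧ (∀ j, 0 < e j) ∧
      ∀ (n : ℕ) (x : box d n) (i : Fin q) (ω ω' : Config d q),
        (box d n).restrict ω = (box d n).restrict ω' → ω x ≠ i →
          |c x ω i - c x ω' i| ≤ e (n - supNorm (x : Fin d → ℤ)) := by
  set α : (Fin d → ℤ) → ℝ≥0∞ := fun y => ⨆ x : Fin d → ℤ, ∑ i,
      osc (x + y) (fun η => if η x = i then 0 else c x η i) with hα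
  set E : ℕ → ℝ≥0∞ := fun j => ∑' y : Fin d → ℤ, (if j < supNorm y then α y else 0) with hE
  have hEsum : ∑' j, E j ≠ ⊤ := by
    rw [hE, tsum_tsum_if_lt]
    exact hc.decay.ne
  -- The geometric term makes every weight strictly positive, so that vanishing weighted dissipation
  -- implies vanishing dissipation at each site.
  refine ⟨fun j => (E j).toReal + (1 / 2) ^ j,
    (ENNReal.summable_toReal hEsum).add summable_geometric_two,
    fun j => add_pos_of_nonneg_of_pos ENNReal.toReal_nonneg (by positivity), ?_⟩
  intro n x i ω ω' h hi
  set f : Config d q → ℝ := fun η => if η x = i then 0 else c x η i with hf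
  have hag : ∀ z ∈ box d n, ω z = ω' z := fun z hz => congrFun h ⟨z, hz⟩
  have hcont : Continuous f := by
    have h1 : Continuous fun η : Config d q => (if η x = i then (0 : ℝ) else 1) * c x η i :=
      ((continuous_of_discreteTopology (f := fun a : Fin q => if a = i then (0 : ℝ) else 1)).comp
        (continuous_apply (x : Fin d → ℤ))).mul (hc.continuous x i)
    convert h1 using 2 with η
    simp only [hf]
    split_ifs <;> simp
  have h1 : c x ω i - c x ω' i = f ω - f ω' := by
    simp only [hf, if_neg hi, ← hag x x.2]
  have h2 := ofReal_abs_sub_le_tsum hcont (box d n) hag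
  have h3 : (∑' z, if z ∈ box d n then 0 else osc z f) ≤ E (n - supNorm (x : Fin d → ℤ)) := by
    rw [← (Equiv.addLeft (x : Fin d → ℤ)).tsum_eq]
    refine ENNReal.tsum_le_tsum fun y => ?_
    show (if (x : Fin d → ℤ) + y ∈ box d n then 0 else osc ((x : Fin d → ℤ) + y) f) ≤
      if n - supNorm (x : Fin d → ℤ) < supNorm y then α y else 0
    by_cases hy : (x : Fin d → ℤ) + y ∈ box d n
    · simp [hy]
    · rw [if_neg hy, if_pos]
      · refine le_iSup_of_le (x : Fin d → ℤ) ?_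
        exact Finset.single_le_sum (f := fun i => osc ((x : Fin d → ℤ) + y)
          (fun η => if η x = i then 0 else c x η i)) (fun _ _ => zero_le) (Finset.mem_univ i)
      -- If |x| ≤ n and x + y lies outside the box, then |y| > n - |x|.
      · rw [mem_box] at hy
        have h4 := supNorm_add_le (x : Fin d → ℤ) y
        have h5 := mem_box.1 x.2
        omega
  have h4 : E (n - supNorm (x : Fin d → ℤ)) ≠ ⊤ := ENNReal.ne_top_of_tsum_ne_top hEsum _
  rw [h1]
  have h5 : |f ω - f ω'| ≤ (E (n - supNorm (x : Fin d → ℤ))).toReal :=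
    (ENNReal.ofReal_le_iff_le_toReal h4).1 (h2.trans h3)
  have h6 : (0 : ℝ) < (1 / 2) ^ (n - supNorm (x : Fin d → ℤ)) := by positivity
  linarith

theorem RateAssumptions.exists_bound (hc : RateAssumptions c) :
    ∃ C : ℝ, 0 < C ∧ ∀ x ω, ∑ i, c x ω i ≤ C := by
  have hb := hc.bounded
  set B := ⨆ x, ∑ i, ⨆ η, ENNReal.ofReal |c x η i| with hB
  refine ⟨B.toReal + 1, by positivity, fun x ω => ?_⟩
  have h1 : ENNReal.ofReal (∑ i, c x ω i) ≤ B := by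
    calc ENNReal.ofReal (∑ i, c x ω i) ≤ ENNReal.ofReal (∑ i, |c x ω i|) :=
          ENNReal.ofReal_le_ofReal (Finset.sum_le_sum fun i _ => le_abs_self _)
      _ = ∑ i, ENNReal.ofReal |c x ω i| := ENNReal.ofReal_sum_of_nonneg fun i _ => abs_nonneg _
      _ ≤ ∑ i, ⨆ η, ENNReal.ofReal |c x η i| :=
          Finset.sum_le_sum fun i _ => le_iSup (fun η => ENNReal.ofReal |c x η i|) ω
      _ ≤ B := le_iSup (fun x => ∑ i, ⨆ η, ENNReal.ofReal |c x η i|) x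
  have h2 := (ENNReal.ofReal_le_iff_le_toReal hb.ne).1 h1
  linarith

end Rates

/-- Measures are determined by the masses of cylinders over boxes. -/
theorem measure_ext_of_mass_box {m m' : Measure (Config d q)} [IsProbabilityMeasure m]
    [IsProbabilityMeasure m'] (h : ∀ n σ, mass m (box d n) σ = mass m' (box d n) σ) : m = m' := by
  have hmass : ∀ (m : Measure (Config d q)) [IsProbabilityMeasure m] (Λ : Finset (Fin d → ℤ))
      (σ : Λ → Fin q), mass m Λ σ = m.real (Λ.restrict ⁻¹' {σ}) := by
    intro m _ Λ σ
    rw [← integral_indicator_one (measurableSet_singleton σ |>.preimage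
      (Finset.measurable_restrict Λ))]
    refine integral_congr_ae (Eventually.of_forall fun ω => ?_)
    rw [ind_apply]
    by_cases hω : Λ.restrict ω = σ
    · rw [if_pos hω, Set.indicator_of_mem (by exact hω)]
      rfl
    · rw [if_neg hω, Set.indicator_of_notMem (by exact hω)]
  have hbox : ∀ n, m.map (box d n).restrict = m'.map (box d n).restrict := by
    intro n
    apply Measure.ext_of_singleton
    intro σ
    rw [Measure.map_apply (Finset.measurable_restrict _) (measurableSet_singleton σ),
      Measure.map_apply (Finset.measurable_restrict _) (measurableSet_singleton σ)]
    have := h n σ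
    rw [hmass, hmass] at this
    exact (measureReal_eq_measureReal_iff).1 this
  have hall : ∀ Λ : Finset (Fin d → ℤ), m.map Λ.restrict = m'.map Λ.restrict := by
    intro Λ
    have hsub : Λ ⊆ box d (Λ.sup supNorm) := fun x hx => mem_box.2 (Finset.le_sup hx)
    have h1 := congrArg (Measure.map (Finset.restrict₂ (π := fun _ => Fin q) hsub)) (hbox (Λ.sup supNorm))
    rwa [Measure.map_map (Finset.measurable_restrict₂ hsub) (Finset.measurable_restrict _),
      Measure.map_map (Finset.measurable_restrict₂ hsub) (Finset.measurable_restrict _)] at h1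
  have i1 : ∀ Λ : Finset (Fin d → ℤ), IsFiniteMeasure (m'.map Λ.restrict) := fun Λ => inferInstance
  -- Boxes are cofinal, so they determine all finite-dimensional marginals and with them the
  -- measure.
  exact IsProjectiveLimit.unique (P := fun Λ => m'.map Λ.restrict) (fun Λ => hall Λ) fun Λ => rfl

/-! ### Weighted dissipation in boxes -/

/-- The dissipation in the box of size `n`, the site `x` having the weight `∑ j ≤ n - |x|, e j`. -/
noncomputable def weightedDissipation (r : (Fin d → ℤ) → Fin q → C(Config d q, ℝ)) (e : ℕ → ℝ)
    (m : Measure (Config d q)) (n : ℕ) : ℝ :=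
  ∑ x : box d n, (∑ j ∈ Finset.range (n - supNorm (x : Fin d → ℤ) + 1), e j) *
    dissipation r m (box d n) x

section

variable {r : (Fin d → ℤ) → Fin q → C(Config d q, ℝ)} {m : Measure (Config d q)} {e : ℕ → ℝ}

theorem weightedDissipation_nonneg (hpos : ∀ Λ σ x i, 0 < flow r m Λ σ x i) (he0 : ∀ j, 0 < e j)
    (n : ℕ) : 0 ≤ weightedDissipation r e m n :=
  Finset.sum_nonneg fun x _ => mul_nonneg (Finset.sum_nonneg fun j _ => (he0 j).le)
    (dissipation_nonneg (hpos _) x)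

theorem dissipation_eq_zero_of_weightedDissipation (hpos : ∀ Λ σ x i, 0 < flow r m Λ σ x i)
    (he0 : ∀ j, 0 < e j) {n : ℕ} (h : weightedDissipation r e m n = 0) (x : box d n) :
    dissipation r m (box d n) x = 0 := by
  rw [weightedDissipation, Finset.sum_eq_zero_iff_of_nonneg fun x _ =>
    mul_nonneg (Finset.sum_nonneg fun j _ => (he0 j).le) (dissipation_nonneg (hpos _) x)] at h
  refine (mul_eq_zero.1 (h x (Finset.mem_univ x))).resolve_left ?_
  exact (Finset.sum_pos (fun j _ => he0 j) (by simp)).ne'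

/-- When the box grows by one layer, the weight of x gains the term e(n+1-|x|), while the rest of
its contribution cannot drop because dissipation is monotone in the volume. -/
theorem sum_mul_dissipation_le_sub [IsProbabilityMeasure m]
    (hpos : ∀ Λ σ x i, 0 < flow r m Λ σ x i) (n : ℕ) (he0 : ∀ j, 0 < e j) :
    ∑ x : box d (n + 1), e (n + 1 - supNorm (x : Fin d → ℤ)) * dissipation r m (box d (n + 1)) x ≤
      weightedDissipation r e m (n + 1) - weightedDissipation r e m n := by
  let g : (Fin d → ℤ) → ℝ := fun x => if h : x ∈ box d n then
    (∑ j ∈ Finset.range (n - supNorm x + 1), e j) * dissipation r m (box d n) ⟨x, h⟩ else 0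
  have hsub := box_mono d (Nat.le_succ n)
  have h1 : weightedDissipation r e m n = ∑ x : box d (n + 1), g x := by
    rw [Finset.sum_coe_sort (box d (n + 1)) g, ← Finset.sum_subset hsub
      (fun x _ hx => dif_neg hx), ← Finset.sum_coe_sort (box d n) g]
    exact Finset.sum_congr rfl fun x _ => (show g x = _ from dif_pos x.2).symm
  rw [h1, weightedDissipation, ← Finset.sum_sub_distrib]
  refine Finset.sum_le_sum fun x _ => ?_
  have hx := mem_box.1 x.2
  by_cases hxn : (x : Fin d → ℤ) ∈ box d n
  · have hx' := mem_box.1 hxn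
    have h2 : g x = (∑ j ∈ Finset.range (n - supNorm (x : Fin d → ℤ) + 1), e j) *
      dissipation r m (box d n) ⟨x, hxn⟩ := dif_pos hxn
    have h3 := mul_le_mul_of_nonneg_left (dissipation_mono hsub (hpos _) ⟨x, hxn⟩)
      (Finset.sum_nonneg fun j (_ : j ∈ Finset.range (n - supNorm (x : Fin d → ℤ) + 1)) =>
        (he0 j).le)
    rw [h2, Finset.sum_range_succ _ (n + 1 - supNorm (x : Fin d → ℤ)), add_mul,
      show n + 1 - supNorm (x : Fin d → ℤ) = n - supNorm (x : Fin d → ℤ) + 1 by omega]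
    linarith
  -- On the new layer |x| = n + 1 the weight is e 0 alone, which equals the coefficient on the left.
  · have h2 : g x = 0 := dif_neg hxn
    rw [mem_box] at hxn
    rw [h2, show n + 1 - supNorm (x : Fin d → ℤ) = 0 by omega]
    simp

/-- Cauchy-Schwarz splits the boundary errors into Σ e(n+1-|x|) = O(n) and the increment of the
weighted dissipation. The constant is 256 = 8 · 4² · 2, from the sphere count, the factor 4 / δ
squared and the 2 C under the root. -/
theorem sum_sqrt_le [IsProbabilityMeasure m] (hd : d = 1 ∨ d = 2)
    (hpos : ∀ Λ σ x i, 0 < flow r m Λ σ x i) (he : Summable e) (he0 : ∀ j, 0 < e j)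
    {δ C l : ℝ} (hδ : 0 < δ) (hC : 0 < C) (hl : 0 < l) (n : ℕ) :
    ∑ x : box d (n + 1), (-dissipation r m (box d (n + 1)) x +
        4 * e (n + 1 - supNorm (x : Fin d → ℤ)) / δ *
          √(2 * C * dissipation r m (box d (n + 1)) x)) / 2 ≤
      (-weightedDissipation r e m (n + 1) / (∑' j, e j) +
        (l * (256 * C / δ ^ 2 * (∑' j, e j) * (n + 2) *
          (weightedDissipation r e m (n + 1) - weightedDissipation r e m n)) + l⁻¹) / 2) / 2 := by
  have hE : 0 < ∑' j, e j := he.tsum_pos (fun j => (he0 j).le) 0 (he0 0)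
  set E := ∑' j, e j with hEdef
  set D : box d (n + 1) → ℝ := dissipation r m (box d (n + 1)) with hD
  set a : box d (n + 1) → ℝ := fun x => e (n + 1 - supNorm (x : Fin d → ℤ)) with ha
  have hD0 : ∀ x, 0 ≤ D x := fun x => dissipation_nonneg (hpos _) x
  have ha0 : ∀ x, 0 < a x := fun x => he0 _
  have hV := sum_mul_dissipation_le_sub hpos n he0
  have hsuma : ∑ x, a x ≤ 8 * (n + 2) * E := by
    have := sum_box_le hd (fun j => (he0 j).le) he (n + 1)
    rw [← Finset.sum_coe_sort] at this
    push_cast at this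
    linarith
  have hW : weightedDissipation r e m (n + 1) / E ≤ ∑ x, D x := by
    rw [div_le_iff₀ hE, Finset.sum_mul]
    refine Finset.sum_le_sum fun x _ => ?_
    rw [mul_comm]
    exact mul_le_mul_of_nonneg_left (he.sum_le_tsum _ fun j _ => (he0 j).le) (hD0 x)
  set Q := ∑ x, 4 * a x / δ * √(2 * C * D x) with hQ
  have hQ2 : Q ^ 2 ≤ 256 * C / δ ^ 2 * E * (n + 2) *
      (weightedDissipation r e m (n + 1) - weightedDissipation r e m n) := by
    have h1 : Q ^ 2 ≤ (∑ x, a x) * ∑ x, 32 * C / δ ^ 2 * (a x * D x) := by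
      apply Finset.sum_sq_le_sum_mul_sum_of_sq_le_mul
      · exact fun x _ => (ha0 x).le
      · intro x _
        have := ha0 x; have := hD0 x
        positivity
      · intro x _
        have h2 : 0 ≤ 2 * C * D x := by have := hD0 x; positivity
        rw [mul_pow, Real.sq_sqrt h2]
        apply le_of_eq
        field_simp
        ring
    rw [← Finset.mul_sum] at h1
    have h3 : 0 ≤ ∑ x, a x * D x := Finset.sum_nonneg fun x _ => mul_nonneg (ha0 x).le (hD0 x)
    calc Q ^ 2 ≤ _ := h1
      _ ≤ (8 * (n + 2) * E) * (32 * C / δ ^ 2 *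
          (weightedDissipation r e m (n + 1) - weightedDissipation r e m n)) := by
        gcongr
      _ = _ := by ring
  -- Young's inequality, so that no square root has to be integrated in time.
  have hAM : Q ≤ (l * Q ^ 2 + l⁻¹) / 2 := by
    have h1 : 0 ≤ (l * Q - 1) ^ 2 * l⁻¹ := by positivity
    have h2 : (l * Q - 1) ^ 2 * l⁻¹ = l * Q ^ 2 - 2 * Q + l⁻¹ := by field_simp; ring
    linarith
  have h4 := mul_le_mul_of_nonneg_left hQ2 hl.le
  rw [← Finset.sum_div, Finset.sum_add_distrib, Finset.sum_neg_distrib, neg_div]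
  linarith

end

/-! ### Absence of periodic orbits -/

namespace MarkovSemigroup

variable {S : MarkovSemigroup d q} {ν μ : ProbabilityMeasure (Config d q)}
  {r : (Fin d → ℤ) → Fin q → C(Config d q, ℝ)}

theorem continuousOn_weightedDissipation (e : ℕ → ℝ) (n : ℕ)
    (hpos : ∀ t, 0 < t → ∀ Λ σ x i, 0 < flow r (S.law ν t) Λ σ x i) :
    ContinuousOn (fun t => weightedDissipation r e (S.law ν t) n) (Set.Ioi 0) := by
  refine continuousOn_finsetSum _ fun x _ => continuousOn_const.mul
    (continuousOn_finsetSum _ fun j _ => ?_)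
  have hc := fun σ i => (continuous_flow (S := S) ν (r := r) (box d n) σ x i).continuousOn
    (s := Set.Ioi 0)
  exact (((hc _ _).sub (hc _ _)).pow 2).div ((hc _ _).add (hc _ _)) fun t ht =>
    (add_pos (hpos t ht _ _ _ _) (hpos t ht _ _ _ _)).ne'

/-- The relative entropy with respect to `μ` in the volume `Λ`. -/
noncomputable def entropy (S : MarkovSemigroup d q) (ν μ : ProbabilityMeasure (Config d q))
    (Λ : Finset (Fin d → ℤ)) (t : ℝ) : ℝ :=
  ∑ σ, mass (S.law ν t) Λ σ *
    (Real.log (mass (S.law ν t) Λ σ) - Real.log (mass (μ : Measure (Config d q)) Λ σ))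

theorem IsGeneratedBy.hasDerivAt_entropy (hS : S.IsGeneratedBy fun x η i => r x i η)
    (hpos : ∀ t, 0 < t → ∀ Λ σ, 0 < mass (S.law ν t) Λ σ) (Λ : Finset (Fin d → ℤ)) {t : ℝ}
    (ht : 0 < t) :
    HasDerivAt (S.entropy ν μ Λ) (∑ σ, (∑ x : Λ, ∑ i,
      (flow r (S.law ν t) Λ (Function.update σ x i) x (σ x) - flow r (S.law ν t) Λ σ x i)) *
        (Real.log (mass (S.law ν t) Λ σ) -
          Real.log (mass (μ : Measure (Config d q)) Λ σ) + 1)) t := by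
  refine HasDerivAt.fun_sum fun σ _ => ?_
  have h1 := hS.hasDerivAt_mass ν Λ σ ht
  have h2 := hpos t ht Λ σ
  refine (h1.mul ((h1.log h2.ne').sub_const _)).congr_deriv ?_
  field_simp

theorem IsGeneratedBy.evolve_eq_of_periodic (hd : d = 1 ∨ d = 2)
    (hS : S.IsGeneratedBy fun x η i => r x i η) (hμ : S.IsReversible μ)
    {δ C : ℝ} (hδ : 0 < δ) (hr : ∀ x i ω, δ ≤ r x i ω) (hC0 : 0 < C)
    (hC : ∀ x ω, ∑ i, r x i ω ≤ C) {e : ℕ → ℝ} (he : Summable e) (he0 : ∀ j, 0 < e j)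
    (hdecay : ∀ (n : ℕ) (x : box d n) (i : Fin q) (ω ω' : Config d q),
        (box d n).restrict ω = (box d n).restrict ω' → ω x ≠ i →
          |r x i ω - r x i ω'| ≤ e (n - supNorm (x : Fin d → ℤ)))
    {T : ℝ≥0} (hT : 0 < T) (hper : ∀ t, S.evolve ν t = S.evolve ν (t + T)) (t : ℝ≥0) :
    S.evolve ν t = S.evolve ν T := by
  have hr' : ∀ x i ω, r x i ω ≤ C := fun x i ω =>
    (Finset.single_le_sum (f := fun i => r x i ω) (fun j _ => hδ.le.trans (hr x j ω))
      (Finset.mem_univ i)).trans (hC x ω)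
  have hmass : ∀ (ν : ProbabilityMeasure (Config d q)) (t : ℝ), 0 < t →
      ∀ Λ σ, 0 < mass (S.law ν t) Λ σ := fun ν t ht Λ σ => hS.mass_pos ν hδ hr hr' Λ σ ht
  have hflow : ∀ t : ℝ, 0 < t → ∀ Λ σ x i, 0 < flow r (S.law ν t) Λ σ x i := fun t ht Λ σ x i =>
    (mul_pos hδ (hmass ν t ht Λ σ)).trans_le (le_flow r _ Λ hr σ x i)
  -- Reversibility makes μ invariant, so it inherits the positivity of laws at time 1.
  have hmassμ : ∀ Λ σ, 0 < mass (μ : Measure (Config d q)) Λ σ := by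
    intro Λ σ
    have := hmass μ 1 one_pos Λ σ
    rwa [law, hμ.evolve_eq] at this
  have hT' : (0 : ℝ) < T := hT
  -- The period [T, 2T] is used because positivity of masses, and so differentiability of the
  -- entropy, is available only at positive times.
  set b : ℝ := T + T with hb
  have hTb : (T : ℝ) ≤ b := by linarith
  have hIcc : Set.Icc (T : ℝ) b ⊆ Set.Ioi 0 := fun s hs => hT'.trans_le hs.1
  have hlaw : S.law ν b = S.law ν T := by
    rw [law, law, hb, ← NNReal.coe_add, Real.toNNReal_coe, Real.toNNReal_coe, ← hper]
  let W : ℕ → ℝ → ℝ := fun n t => weightedDissipation r e (S.law ν t) n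
  have hWc : ∀ n, ContinuousOn (W n) (Set.Icc T b) := fun n =>
    (continuousOn_weightedDissipation e n hflow).mono hIcc
  have hW0 : ∀ n, ∀ t ∈ Set.Icc (T : ℝ) b, 0 ≤ W n t := fun n t ht =>
    weightedDissipation_nonneg (hflow t (hIcc ht)) he0 n
  have hWmono : ∀ n, ∀ t ∈ Set.Icc (T : ℝ) b, W n t ≤ W (n + 1) t := fun n t ht => by
    have h1 := sum_mul_dissipation_le_sub (hflow t (hIcc ht)) n he0
    have h2 : 0 ≤ ∑ x : box d (n + 1), e (n + 1 - supNorm (x : Fin d → ℤ)) *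
        dissipation r (S.law ν t) (box d (n + 1)) x :=
      Finset.sum_nonneg fun x _ => mul_nonneg (he0 _).le
        (dissipation_nonneg (hflow t (hIcc ht) _) x)
    exact sub_nonneg.1 (h2.trans h1)
  have hE : 0 < ∑' j, e j := he.tsum_pos (fun j => (he0 j).le) 0 (he0 0)
  set E := ∑' j, e j with hEdef
  set A := 256 * C / δ ^ 2 * E with hA
  have hA0 : 0 < A := by positivity
  have hint : ∀ n, ∫ t in (T : ℝ)..b, W n t = 0 :=
    integral_eq_zero_of_forall_deriv_le (by linarith) hE hA0 hWc hW0 hWmono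
      (fun n t ht => hS.hasDerivAt_entropy (μ := μ) (hmass ν) (box d n) (hIcc ht))
      (fun n => by simp only [entropy, hlaw]) fun n l hl t ht =>
        (entropy_production_le hδ hr hC (hmass ν t (hIcc ht) _) (hmassμ _)
          (fun σ x i => hμ.flow_eq hS _ σ x i) (fun x => (he0 _).le) (hdecay (n + 1))).trans
          (sum_sqrt_le hd (hflow t (hIcc ht)) he he0 hδ hC0 hl n)
  have hWz : ∀ n, ∀ t ∈ Set.Icc (T : ℝ) b, W n t = 0 := by
    intro n t ht
    by_contra hne
    exact absurd (hint n) (intervalIntegral.integral_pos (by linarith) (hWc n)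
      (fun s hs => hW0 n s (Set.Ioc_subset_Icc_self hs))
      ⟨t, ht, lt_of_le_of_ne (hW0 n t ht) (Ne.symm hne)⟩).ne'
  -- Zero dissipation balances every jump with its reversal, so each cylinder mass has zero
  -- derivative.
  have hconst : ∀ t ∈ Set.Icc (T : ℝ) b, S.law ν t = S.law ν T := by
    intro t ht
    refine measure_ext_of_mass_box fun n σ => ?_
    refine constant_of_has_deriv_right_zero
      (S.continuous_integral_law ν (ind (box d n) σ)).continuousOn (fun s hs => ?_) t ht
    have hs' := Set.Ico_subset_Icc_self hs
    have h1 := hS.hasDerivAt_mass ν (box d n) σ (hIcc hs')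
    have h2 : ∑ x : box d n, ∑ i, (flow r (S.law ν s) (box d n) (Function.update σ x i) x (σ x) -
        flow r (S.law ν s) (box d n) σ x i) = 0 :=
      Finset.sum_eq_zero fun x _ => Finset.sum_eq_zero fun i _ => sub_eq_zero.2
        (flow_reverse_eq_of_dissipation_eq_zero (hflow s (hIcc hs') _)
          (dissipation_eq_zero_of_weightedDissipation (hflow s (hIcc hs')) he0 (hWz n s hs') x) σ i)
    rw [h2] at h1
    exact h1.hasDerivWithinAt
  have hfirst : ∀ s : ℝ≥0, s ≤ T → S.evolve ν s = S.evolve ν T := by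
    intro s hs
    rw [hper s]
    have hs' : (s : ℝ) ≤ T := hs
    have h1 := hconst ((s + T : ℝ≥0) : ℝ) ⟨by simp, by push_cast; linarith⟩
    rw [law, law, Real.toNNReal_coe, Real.toNNReal_coe] at h1
    exact Subtype.ext h1
  -- Constancy on the first period is carried to all times by subtracting periods.
  have hall : ∀ (k : ℕ) (s : ℝ≥0), s ≤ k * T → S.evolve ν s = S.evolve ν T := by
    intro k
    induction k with
    | zero => exact fun s hs => hfirst s (hs.trans (by simp))
    | succ k ih =>
      intro s hs
      rcases le_total s T with h | h
      · exact hfirst s h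
      · rw [← ih (s - T) ?_, hper (s - T), tsub_add_cancel_of_le h]
        rw [tsub_le_iff_right]
        calc s ≤ _ := hs
          _ = _ := by push_cast; ring
  obtain ⟨k, hk⟩ := exists_nat_ge (t / T)
  exact hall k t ((div_le_iff₀ hT).1 hk)

end MarkovSemigroup

end IPS

/-- Non-existence of time-periodic orbits. Detailed balance follows from reversibility alone, so that
the specification `γ` does not enter the argument. -/
theorem mainTheorem2 (d q : ℕ) (hd : d = 1 ∨ d = 2)
    (c : (Fin d → ℤ) → IPS.Config d q → Fin q → ℝ) (hc : IPS.RateAssumptions c)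
    (γ : IPS.Specification d q) (hγ : IPS.SpecAssumptions γ)
    (S : IPS.MarkovSemigroup d q) (hS : S.IsGeneratedBy c)
    (μ : MeasureTheory.ProbabilityMeasure (IPS.Config d q))
    (hμ : IPS.IsGibbs γ μ) (hrev : S.IsReversible μ) :
    ¬ ∃ ν : MeasureTheory.ProbabilityMeasure (IPS.Config d q),
      (∃ s t : NNReal, S.evolve ν s ≠ S.evolve ν t) ∧
        ∃ T : NNReal, 0 < T ∧ ∀ t : NNReal, S.evolve ν t = S.evolve ν (t + T) := by
  rintro ⟨ν, ⟨s, t, hst⟩, T, hT, hper⟩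
  obtain ⟨δ, hδ, hr⟩ := hc.positive
  obtain ⟨C, hC0, hC⟩ := hc.exists_bound
  obtain ⟨e, he, he0, hdecay⟩ := hc.exists_summable_bound
  have key := IPS.MarkovSemigroup.IsGeneratedBy.evolve_eq_of_periodic
    (r := fun x i => ⟨fun η => c x η i, hc.continuous x i⟩) (S := S) (ν := ν) hd hS hrev hδ
    (fun x i ω => hr x ω i) hC0 hC he he0 hdecay hT hper
  exact hst ((key s).trans (key t).symm)
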